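/- Let $N\ge 1$ be square-free, let $n\ge 1$ be an integer with $(n,N)=1$, and let $s\in\mathbb C$ with $\Re s>1$. Matrices of determinant one are regarded as elements of $PSL(2,\mathbb R)$, that is, up to sign. Put $$k(t)=(1+t/4)^{-s},\qquad k(z,z')=k\!\left(\frac{|z-z'|^2}{\Im z\,\Im z'}\right),\qquad g(u)=\int_{w_u}^\infty \frac{k(t)\,dt}{\sqrt{t-w_u}},\quad w_u=e^u+e^{-u}-2,$$ $$\Gamma^*=\bigcup_{ad=n,\;0\le b<d}\frac1{\sqrt n}\begin{pmatrix} d&-b\\0&a\end{pmatrix}\Gamma_0(N).$$ For $T\in\Gamma^*$ let $\Gamma_T$ be the group of elements of $\Gamma_0(N)$ that commute with $T$. Let $\mathfrak a_i=\sigma_i\infty$ ($\sigma_i\in PSL(2,\mathbb R)$) be a complete set of inequivalent cusps of $\Gamma_0(N)$ with $\sigma_i^{-1}\Gamma_{\mathfrak a_i}\sigma_i=\Gamma_\infty=\{z\mapsto z+m:m\in\mathbb Z\}$, where $\Gamma_{\mathfrak a_i}$ is the stabilizer of $\mathfrak a_i$ in $\Gamma_0(N)$. Let $D$ be a fundamental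 domain of $\Gamma_0(N)$ in the upper half-plane whose cusps are the $\mathfrak a_i$; that is, there is $Y_0$ such that if $z\in D$, $\gamma\in\Gamma_0(N)$ and $\Im\sigma_i^{-1}\gamma z>Y_0$, then $\gamma\mathfrak a_i=\mathfrak a_i$. For $Y>0$ put $D_Y=\{z\in D:\Im\sigma_i^{-1}z<Y \text{ for all } i\}$, and for hyperbolic $P\in\Gamma^*$ with $\Gamma_P=\{1\}$ put $$c(P)_Y=\int_{\bigcup_{\gamma\in\Gamma_0(N)}\gamma D_Y}k(z,Pz)\,\frac{dx\,dy}{y^2},$$ which depends only on the $\Gamma_0(N)$-conjugacy class $\{P\}$. Let $\nu(N)=\sum_{w\mid N}\varphi((w,N/w))$. Then there are only finitely many $\Gamma_0(N)$-conjugacy classes of hyperbolic $P\in\Gamma^*$ with $\Gamma_P=\{1\}$; for all sufficiently large $Y$ the integrals $c(P)_Y$ converge absolutely for all such $P$; and, as $Y\to\infty$, $$\begin{aligned}\sum_{\{P\},\,\Gamma_P=\{1\}}c(P)_Y={}&\nu(N)\sqrt n\sum_{ad=n,\;d>0,\;a\ne d}g\!\left(\ln\frac ad\right)\ln Y\\&+\frac{\sqrt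 n}2\sum_{w\mid N,\;w>0}\;\sum_{ad=n,\;d>0,\;a\ne d}\;\sum_b\frac{\ln\{(a-d)^2wN\,[C^2/\ell^2,N]/C^2\}}{|a-d|}\,g\!\left(\ln\frac ad\right)\\&+\sum_{ad=n,\;d>0,\;a\ne d}\frac12\nu(N)\,|a-d|\int_1^\infty k\!\left(\frac{(a-d)^2}nt\right)\frac{\ln t}{\sqrt{t-1}}\,dt+o(1).\end{aligned}$$ The integrals on the right converge absolutely. Here $C=(a-d)w-bwN$, and $\sum_b$ is over the rational numbers $b$ with $0\le b<|a-d|$, $C\in\mathbb Z$, $bN/w\in\mathbb Z$ and $N\mid C$, of which there are exactly $|a-d|$. Moreover $\ell=(C,bN)$ is the greatest common divisor, and $[\cdot,\cdot]$ is the least common multiple. If $C=0$, the quotient $[C^2/\ell^2,N]/C^2$ is read as $1/\ell^2$, the value at $C=0$ of the equal expression $N/(\ell^2\,(C^2/\ell^2,N))$. -/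

import Mathlib

open scoped MatrixGroups UpperHalfPlane OnePoint
open MeasureTheory

namespace HeckeTrace

noncomputable section

/-! ### The kernel -/

/-- `k(t) = (1 + t/4)^(-s)`. -/
def kfun (s : ℂ) (t : ℝ) : ℂ := ((1 + t / 4 : ℝ) : ℂ) ^ (-s)

/-- The point-pair kernel `k(z, z') = k(|z - z'|² / (y y'))`. -/
def kernel (s : ℂ) (z z' : ℍ) : ℂ :=
  kfun s (‖(z : ℂ) - (z' : ℂ)‖ ^ 2 / (z.im * z'.im))

/-- `g(u) = ∫_w^∞ k(t) dt / √(t - w)` with `w = e^u + e^(-u) - 2`. -/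
def gfun (s : ℂ) (u : ℝ) : ℂ :=
  ∫ t in Set.Ioi (Real.exp u + Real.exp (-u) - 2),
    kfun s t / ((√(t - (Real.exp u + Real.exp (-u) - 2)) : ℝ) : ℂ)

/-! ### The groups and the Hecke set `Γ*`

Everything happens in `PSL(2, ℝ)`; an element of it is handled through its two
representatives `± T` in `SL(2, ℝ)`. -/

/-- `Γ₀(N)` as a subgroup of `SL(2, ℝ)`. -/
def Gam (N : ℕ) : Subgroup SL(2, ℝ) :=
  (CongruenceSubgroup.Gamma0 N).map (Matrix.SpecialLinearGroup.map (Int.castRingHom ℝ))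

/-- The set `Γ*`: the union over `ad = n`, `0 ≤ b < d` of `n^(-1/2) (d, -b; 0, a) Γ₀(N)`. -/
def GamStar (N n : ℕ) : Set SL(2, ℝ) :=
  {T | ∃ a d b : ℕ, a * d = n ∧ b < d ∧ ∃ γ ∈ Gam N,
    (T : Matrix (Fin 2) (Fin 2) ℝ) =
      (1 / √(n : ℝ)) •
        (!![(d : ℝ), -(b : ℝ); 0, (a : ℝ)] * (γ : Matrix (Fin 2) (Fin 2) ℝ))}

/-- `Γ_T = {1}` in `PSL(2, ℝ)`: every `γ ∈ Γ₀(N)` commuting with `T` up to sign is `± 1`. -/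
def TrivialCentralizer (N : ℕ) (T : SL(2, ℝ)) : Prop :=
  ∀ γ ∈ Gam N, (γ * T = T * γ ∨ γ * T = -(T * γ)) → γ = 1 ∨ γ = -1

/-- The hyperbolic elements `P ∈ Γ*` with `Γ_P = {1}`. -/
def HypTriv (N n : ℕ) : Type :=
  {P : SL(2, ℝ) // P ∈ GamStar N n ∧ (P : Matrix (Fin 2) (Fin 2) ℝ).IsHyperbolic ∧
    TrivialCentralizer N P}

/-- Conjugacy under `Γ₀(N)` in `PSL(2, ℝ)`. -/
def Conj (N : ℕ) (P P' : SL(2, ℝ)) : Prop :=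
  ∃ γ ∈ Gam N, P' = γ * P * γ⁻¹ ∨ P' = -(γ * P * γ⁻¹)

theorem Conj.equivalence (N : ℕ) : Equivalence (Conj N) where
  refl P := ⟨1, one_mem _, Or.inl (by simp)⟩
  symm := by
    rintro P P' ⟨γ, hγ, h | h⟩
    · exact ⟨γ⁻¹, inv_mem hγ, Or.inl (by rw [h]; group)⟩
    · refine ⟨γ⁻¹, inv_mem hγ, Or.inr ?_⟩
      rw [h, mul_neg, neg_mul, neg_neg]; group
  trans := by
    rintro P Q R ⟨γ, hγ, h⟩ ⟨δ, hδ, h'⟩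
    refine ⟨δ * γ, mul_mem hδ hγ, ?_⟩
    rcases h with rfl | rfl <;> rcases h' with rfl | rfl
    · exact Or.inl (by group)
    · exact Or.inr (by rw [neg_inj]; group)
    · exact Or.inr (by rw [mul_neg, neg_mul, neg_inj]; group)
    · exact Or.inl (by rw [mul_neg, neg_mul, neg_neg]; group)

instance hypTrivSetoid (N n : ℕ) : Setoid (HypTriv N n) where
  r P P' := Conj N P.1 P'.1
  iseqv := ⟨fun P => (Conj.equivalence N).refl P.1, fun h => (Conj.equivalence N).symm h,
    fun h h' => (Conj.equivalence N).trans h h'⟩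

/-- The conjugacy classes `{P}` of hyperbolic `P ∈ Γ*` with `Γ_P = {1}`. -/
def HypClass (N n : ℕ) : Type := Quotient (hypTrivSetoid N n)

/-! ### Cusps, fundamental domains, truncation -/

/-- The point `g ∞` of the real projective line. -/
def cuspOf (g : SL(2, ℝ)) : OnePoint ℝ := Matrix.SpecialLinearGroup.mapGL ℝ g • (∞ : OnePoint ℝ)

/-- `σ` is a family of scaling matrices: the points `𝔞_i = σ_i ∞` form a complete set of
inequivalent cusps of `Γ₀(N)`, and `σ_i⁻¹ Γ_{𝔞_i} σ_i = Γ_∞` in `PSL(2, ℝ)`, where `Γ_∞` is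
the group of integral translations. -/
structure IsCuspSystem {ι : Type*} (N : ℕ) (σ : ι → SL(2, ℝ)) : Prop where
  isCusp : ∀ i, IsCusp (cuspOf (σ i))
    ((CongruenceSubgroup.Gamma0 N).map (Matrix.SpecialLinearGroup.mapGL ℝ))
  complete : ∀ c : OnePoint ℝ,
    IsCusp c ((CongruenceSubgroup.Gamma0 N).map (Matrix.SpecialLinearGroup.mapGL ℝ)) →
      ∃! i, ∃ γ ∈ Gam N, Matrix.SpecialLinearGroup.mapGL ℝ γ • c = cuspOf (σ i)
  stabilizer : ∀ i, ∀ γ : SL(2, ℝ),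
    (γ ∈ Gam N ∧ Matrix.SpecialLinearGroup.mapGL ℝ γ • cuspOf (σ i) = cuspOf (σ i)) ↔
      ∃ m : ℤ, (((σ i)⁻¹ * γ * σ i : SL(2, ℝ)) : Matrix (Fin 2) (Fin 2) ℝ) = !![1, (m : ℝ); 0, 1] ∨
        (((σ i)⁻¹ * γ * σ i : SL(2, ℝ)) : Matrix (Fin 2) (Fin 2) ℝ) = -!![1, (m : ℝ); 0, 1]

/-- `D` is a fundamental domain of `Γ₀(N)` in the upper half-plane whose cusps are the points
`𝔞_i = σ_i ∞`: almost every point has a translate in `D`, translates by different elements of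
`PSL` overlap in null sets, and `D` meets a small horoball at a cusp `γ⁻¹ 𝔞_i` only if that cusp
is `𝔞_i` itself. -/
structure IsFundamentalDomainAt {ι : Type*} (N : ℕ) (σ : ι → SL(2, ℝ)) (D : Set ℍ) : Prop where
  nullMeasurable : NullMeasurableSet D volume
  covers : ∀ᵐ z : ℍ, ∃ γ ∈ Gam N, γ • z ∈ D
  overlap : ∀ γ ∈ Gam N, γ ≠ 1 → γ ≠ -1 → volume {z : ℍ | z ∈ D ∧ γ • z ∈ D} = 0
  cusps : ∃ Y₀ : ℝ, ∀ i, ∀ γ ∈ Gam N, ∀ z ∈ D, Y₀ < ((σ i)⁻¹ • γ • z).im →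
    Matrix.SpecialLinearGroup.mapGL ℝ γ • cuspOf (σ i) = cuspOf (σ i)

/-- `D_Y = {z ∈ D : Im σ_i⁻¹ z < Y for all i}`. -/
def truncDomain {ι : Type*} (σ : ι → SL(2, ℝ)) (D : Set ℍ) (Y : ℝ) : Set ℍ :=
  {z | z ∈ D ∧ ∀ i, ((σ i)⁻¹ • z).im < Y}

/-- `(D_P)_Y`, the union of all translates `γ D_Y` with `γ ∈ Γ₀(N)`. -/
def truncPlane {ι : Type*} (N : ℕ) (σ : ι → SL(2, ℝ)) (D : Set ℍ) (Y : ℝ) : Set ℍ :=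
  ⋃ γ ∈ Gam N, (fun z : ℍ => γ • z) '' truncDomain σ D Y

/-- `c(P)_Y`, the integral of `k(z, Pz)` over `(D_P)_Y` with respect to `dx dy / y²`. -/
def cTrunc {ι : Type*} (s : ℂ) (N : ℕ) (σ : ι → SL(2, ℝ)) (D : Set ℍ) (Y : ℝ)
    (P : SL(2, ℝ)) : ℂ :=
  ∫ z in truncPlane N σ D Y, kernel s z (P • z)

/-! `c(P)_Y` depends only on the conjugacy class of `P`. -/

theorem kernel_smul (s : ℂ) (γ : SL(2, ℝ)) (z w : ℍ) :
    kernel s (γ • z) (γ • w) = kernel s z w := by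
  have key : ∀ u v : ℍ, ‖(u : ℂ) - (v : ℂ)‖ ^ 2 / (u.im * v.im)
      = 2 * (Real.cosh (dist u v) - 1) := by
    intro u v
    rw [UpperHalfPlane.cosh_dist, dist_eq_norm]
    have := u.im_pos.ne'
    have := v.im_pos.ne'
    field_simp
    ring
  unfold kernel
  rw [key, key, dist_smul]

theorem neg_smul_eq (P : SL(2, ℝ)) (z : ℍ) : (-P) • z = P • z := by
  have h : Matrix.SpecialLinearGroup.mapGL ℝ (-P) = -Matrix.SpecialLinearGroup.mapGL ℝ P := by
    ext i j; simp
  change Matrix.SpecialLinearGroup.mapGL ℝ (-P) • z = Matrix.SpecialLinearGroup.mapGL ℝ P • z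
  rw [h, UpperHalfPlane.neg_smul]

theorem preimage_truncPlane {ι : Type*} (N : ℕ) (σ : ι → SL(2, ℝ)) (D : Set ℍ) (Y : ℝ)
    {δ : SL(2, ℝ)} (hδ : δ ∈ Gam N) :
    (fun z : ℍ => δ • z) ⁻¹' truncPlane N σ D Y = truncPlane N σ D Y := by
  ext z
  simp only [truncPlane, Set.mem_preimage, Set.mem_iUnion, Set.mem_image]
  constructor
  · rintro ⟨γ, hγ, x, hx, h⟩
    exact ⟨δ⁻¹ * γ, mul_mem (inv_mem hδ) hγ, x, hx, by rw [mul_smul, h, inv_smul_smul]⟩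
  · rintro ⟨γ, hγ, x, hx, rfl⟩
    exact ⟨δ * γ, mul_mem hδ hγ, x, hx, mul_smul _ _ _⟩

theorem cTrunc_conj {ι : Type*} (s : ℂ) (N : ℕ) (σ : ι → SL(2, ℝ)) (D : Set ℍ) (Y : ℝ)
    {P P' : SL(2, ℝ)} (h : Conj N P P') :
    cTrunc s N σ D Y P = cTrunc s N σ D Y P' := by
  obtain ⟨γ, hγ, h⟩ := h
  have hP' : ∀ z : ℍ, P' • z = γ • P • γ⁻¹ • z := by
    intro z
    rcases h with rfl | rfl
    · simp only [mul_smul]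
    · rw [neg_smul_eq]; simp only [mul_smul]
  have hmp : MeasurePreserving (fun z : ℍ => γ • z) volume volume :=
    measurePreserving_smul (Matrix.SpecialLinearGroup.mapGL ℝ γ) (volume : Measure ℍ)
  have hemb : MeasurableEmbedding (fun z : ℍ => γ • z) :=
    (MeasurableEquiv.smul (α := ℍ) (Matrix.SpecialLinearGroup.mapGL ℝ γ)).measurableEmbedding
  unfold cTrunc
  rw [← hmp.setIntegral_preimage_emb hemb (fun z => kernel s z (P' • z)),
    preimage_truncPlane N σ D Y hγ]
  congr 1
  funext z
  rw [hP', inv_smul_smul, kernel_smul]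

/-- `c(P)_Y` as a function of the conjugacy class `{P}`. -/
def cClass {ι : Type*} (s : ℂ) (N n : ℕ) (σ : ι → SL(2, ℝ)) (D : Set ℍ) (Y : ℝ)
    (c : HypClass N n) : ℂ :=
  Quotient.lift (fun P : HypTriv N n => cTrunc s N σ D Y P.1)
    (fun _ _ h => cTrunc_conj s N σ D Y h) c

/-! ### The explicit side -/

/-- `ν(N) = ∑_{w ∣ N} φ(gcd(w, N/w))`. -/
def nu (N : ℕ) : ℕ := ∑ w ∈ N.divisors, (Nat.gcd w (N / w)).totient

/-- The pairs `(a, d)` of positive integers with `ad = n` and `a ≠ d`. -/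
def pairs (n : ℕ) : Finset (ℕ × ℕ) := n.divisorsAntidiagonal.filter fun p => p.1 ≠ p.2

/-- The numbers `b` with `0 ≤ b < |a - d|` such that `bN/w` and `C = (a - d)w - bwN` are integers
and `N ∣ C`. Such numbers are rational. -/
def bSet (N w a d : ℕ) : Set ℚ :=
  {b | 0 ≤ b ∧ b < |(a : ℚ) - d| ∧ (∃ k : ℤ, b * N / w = k) ∧
    ∃ C : ℤ, ((a : ℚ) - d) * w - b * w * N = C ∧ (N : ℤ) ∣ C}

/-- The integer `C = (a - d)w - bwN` (for `b ∈ bSet N w a d` the rational number is an integer,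
equal to its numerator). -/
def entryC (N w a d : ℕ) (b : ℚ) : ℤ := (((a : ℚ) - d) * w - b * w * N).num

/-- `ℓ = gcd(C, bN)` (for `b ∈ bSet N w a d` the number `bN` is an integer). -/
def ell (N w a d : ℕ) (b : ℚ) : ℕ := Int.gcd (entryC N w a d b) (b * N).num

/-- The quotient `[C²/ℓ², N] / C²`, where `[·,·]` is the least common multiple. For `C = 0` it is
read as `1/ℓ²`, the value at `C = 0` of the equal expression `N / (ℓ² gcd(C²/ℓ², N))`. -/
def lcmRatio (N w a d : ℕ) (b : ℚ) : ℝ :=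
  if entryC N w a d b = 0 then 1 / (ell N w a d b : ℝ) ^ 2
  else (Int.lcm ((entryC N w a d b / (ell N w a d b : ℤ)) ^ 2) (N : ℤ) : ℝ) /
    (entryC N w a d b : ℝ) ^ 2

/-- The summand `ln{(a - d)² w N [C²/ℓ², N] / C²} / |a - d|`. -/
def logTerm (N w a d : ℕ) (b : ℚ) : ℝ :=
  Real.log (((a : ℝ) - d) ^ 2 * w * N * lcmRatio N w a d b) / |(a : ℝ) - d|

/-- The integrand `k((a - d)² t / n) ln t / √(t - 1)`. -/
def tailIntegrand (s : ℂ) (n a d : ℕ) (t : ℝ) : ℂ :=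
  kfun s (((a : ℝ) - d) ^ 2 / n * t) * ((Real.log t / √(t - 1) : ℝ) : ℂ)

end

end HeckeTrace

/-!
The element `P` has a trivial centralizer exactly when its discriminant is a square, because a
solution of Pell's equation for a non-square discriminant gives an element of `Γ₀(N)` commuting
with `P` (`isSquare_discr`). Then, up to sign, `P = n^(-1/2) M` with `M` integral with positive
integral eigenvalues `a ≠ d`, `ad = n`, and the two fixed points of `P` are cusps. Marking one of
them and moving it to `1/w` with `w ∣ N` brings `M` to the form `repMat w a d x`, where `x` matters
only modulo `|a - d|` times the width `N / w`. Each conjugacy class thus has exactly two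
descriptions by parameters `(w, (a, d), x)`, one for either order of the eigenvalues
(`exists_equiv_indexSet`), whence the factor `1/2` in the formula.

Up to null sets and for large `Y`, the region of integration of `c(P)_Y` is the upper half-plane
without the horoballs of normalized height `Y` at all cusps (`truncPlane_ae_eq_thickPart`). Move the
fixed points of `P` to `∞` and `0`; then `P` is the dilation by `a / d`, and in the coordinates
`z = e^v (u + i)` the measure is `du dv` and the kernel depends on `u` only. The horoballs at `∞`
and `0` cut the line of fixed `u` down to a segment of length
`2 ln Y + ln (h₁ h₂ Δ²) + ln (1 + u²)`, with `h₁`, `h₂` the widths of the two cusps and `Δ` the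
determinant of the two fixed points. The horoballs at the other cusps lie below two shrinking
horocycles at `∞` and `0` (`thickPart_between_horocycles`), so their contribution tends to zero by
dominated convergence. Integrating over `u` gives `tendsto_integral_thickPart`: the transform `g`
comes from the terms of the length that do not depend on `u`, and the last integral of the formula
from `ln (1 + u²)`. Finally `h₁ h₂ Δ²` is the argument of the logarithm in the formula
(`exists_second_fixed_point`).
-/

namespace HeckeTrace

noncomputable section

/-! ### Coordinates adapted to dilations -/

/-- The coordinates `z = e^v (u + i)` on the upper half-plane: `v` parametrizes the orbits of the
dilations and `u` is the cotangent of the argument of `z`. -/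
def dilCoord (p : ℝ × ℝ) : ℍ :=
  ⟨⟨Real.exp p.2 * p.1, Real.exp p.2⟩, Real.exp_pos _⟩

theorem dilCoord_injective : Function.Injective dilCoord := by
  rintro ⟨u, v⟩ ⟨u', v'⟩ h
  have h1 : Real.exp v = Real.exp v' := congrArg UpperHalfPlane.im h
  have h2 : Real.exp v * u = Real.exp v' * u' := congrArg UpperHalfPlane.re h
  rw [← h1] at h2
  rw [mul_left_cancel₀ (Real.exp_pos v).ne' h2, Real.exp_injective h1]

theorem dilCoord_surjective : Function.Surjective dilCoord := by
  intro z
  refine ⟨(z.re / z.im, Real.log z.im), UpperHalfPlane.ext (Complex.ext ?_ ?_)⟩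
  · change Real.exp (Real.log z.im) * (z.re / z.im) = z.re
    rw [Real.exp_log z.im_pos, mul_div_cancel₀ _ z.im_pos.ne']
  · exact Real.exp_log z.im_pos

theorem continuous_dilCoord : Continuous dilCoord := by
  rw [UpperHalfPlane.isEmbedding_coe.continuous_iff]
  have : (UpperHalfPlane.coe ∘ dilCoord) =
      fun p : ℝ × ℝ => Complex.equivRealProdCLM.symm (Real.exp p.2 * p.1, Real.exp p.2) := by
    funext p
    apply Complex.ext <;> simp [dilCoord]
  rw [this]
  fun_prop

theorem measurableEmbedding_dilCoord : MeasurableEmbedding dilCoord :=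
  continuous_dilCoord.measurableEmbedding dilCoord_injective

/-- `dx dy / y²` becomes Lebesgue measure `du dv`: the Jacobian of `(u, v) ↦ (x, y)` is `y²`. -/
theorem measurePreserving_dilCoord : MeasurePreserving dilCoord volume volume := by
  refine ⟨continuous_dilCoord.measurable, Measure.ext fun s hs => ?_⟩
  rw [Measure.map_apply continuous_dilCoord.measurable hs, UpperHalfPlane.volume_eq_lintegral]
  set A := dilCoord ⁻¹' s with hA
  have hAm : MeasurableSet A := continuous_dilCoord.measurable hs
  let Φ : ℝ × ℝ → ℝ × ℝ := fun p => (Real.exp p.2 * p.1, Real.exp p.2)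
  let L : ℝ × ℝ → (ℝ × ℝ →L[ℝ] ℝ × ℝ) := fun p =>
    (Matrix.toLin (.finTwoProd ℝ) (.finTwoProd ℝ)
      !![Real.exp p.2, Real.exp p.2 * p.1; 0, Real.exp p.2]).toContinuousLinearMap
  have hΦ : ∀ p, HasFDerivAt Φ (L p) p := by
    intro p
    simp only [L]
    rw [Matrix.toLin_finTwoProd_toContinuousLinearMap]
    convert!
      HasFDerivAt.prodMk (𝕜 := ℝ)
        (((Real.hasDerivAt_exp p.2).comp_hasFDerivAt p hasFDerivAt_snd).mul hasFDerivAt_fst)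
        ((Real.hasDerivAt_exp p.2).comp_hasFDerivAt p hasFDerivAt_snd) using 2 <;>
    simp [smul_smul, mul_comm]
  have hdet : ∀ p, (L p).det = Real.exp p.2 ^ 2 := by
    intro p
    simp only [L, LinearMap.det_toContinuousLinearMap, LinearMap.det_toLin,
      Matrix.det_fin_two_of]
    ring
  have hinj : Set.InjOn Φ A := by
    rintro p - q - h
    apply dilCoord_injective
    have h1 := congrArg Prod.fst h
    have h2 := congrArg Prod.snd h
    exact UpperHalfPlane.ext (Complex.ext h1 h2)
  have himg : UpperHalfPlane.coe '' s = Complex.measurableEquivRealProd ⁻¹' (Φ '' A) := by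
    ext z
    simp only [Set.mem_image, Set.mem_preimage, Complex.measurableEquivRealProd_apply]
    constructor
    · rintro ⟨w, hw, rfl⟩
      obtain ⟨p, rfl⟩ := dilCoord_surjective w
      exact ⟨p, hw, rfl⟩
    · rintro ⟨p, hp, h⟩
      exact ⟨dilCoord p, hp, Complex.ext (congrArg Prod.fst h) (congrArg Prod.snd h)⟩
  have hpre := Complex.volume_preserving_equiv_real_prod.setLIntegral_comp_preimage_emb
    Complex.measurableEquivRealProd.measurableEmbedding
    (fun p : ℝ × ℝ => (((1 / ‖p.2‖₊) ^ 2 : NNReal) : ENNReal)) (Φ '' A)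
  simp only [Complex.measurableEquivRealProd_apply] at hpre
  rw [himg]
  refine Eq.trans ?_ hpre.symm
  rw [lintegral_image_eq_lintegral_abs_det_fderiv_mul volume hAm
      (fun p _ => (hΦ p).hasFDerivWithinAt) hinj, ← setLIntegral_one A]
  refine lintegral_congr fun p => ?_
  have hp := Real.exp_pos p.2
  rw [hdet, abs_of_nonneg (sq_nonneg _)]
  simp only [Φ]
  have : (((1 / ‖Real.exp p.2‖₊) ^ 2 : NNReal) : ENNReal)
      = ENNReal.ofReal ((1 / Real.exp p.2) ^ 2) := by
    rw [ENNReal.ofReal, ENNReal.coe_inj]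
    ext
    rw [Real.coe_toNNReal _ (by positivity)]
    simp
  rw [this, ← ENNReal.ofReal_mul (by positivity), ← mul_pow, mul_one_div_cancel hp.ne']
  simp

/-! ### Integrals over strips -/

/-- The integral of a function of the first coordinate over the region `α(u) < v < β(u)`. -/
theorem integral_strip {f : ℝ → ℂ} {α β : ℝ → ℝ} (hf : Measurable f) (hα : Measurable α)
    (hβ : Measurable β) (hint : Integrable fun u => max (β u - α u) 0 * ‖f u‖) :
    IntegrableOn (fun p : ℝ × ℝ => f p.1) {p | α p.1 < p.2 ∧ p.2 < β p.1} ∧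
    ∫ p in {p : ℝ × ℝ | α p.1 < p.2 ∧ p.2 < β p.1}, f p.1 =
      ∫ u, ((max (β u - α u) 0 : ℝ) : ℂ) * f u := by
  set S : Set (ℝ × ℝ) := {p | α p.1 < p.2 ∧ p.2 < β p.1} with hS
  have hSm : MeasurableSet S :=
    (measurableSet_lt (hα.comp measurable_fst) measurable_snd).inter
      (measurableSet_lt measurable_snd (hβ.comp measurable_fst))
  have hg : Measurable (S.indicator fun p : ℝ × ℝ => f p.1) :=
    (hf.comp measurable_fst).indicator hSm
  have hsec : ∀ u, (fun v => S.indicator (fun p : ℝ × ℝ => f p.1) (u, v)) =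
      (Set.Ioo (α u) (β u)).indicator fun _ => f u := by
    intro u
    funext v
    simp [S, Set.indicator, Set.mem_Ioo]
  have hvol : ∀ u, (volume : Measure ℝ).real (Set.Ioo (α u) (β u)) = max (β u - α u) 0 := by
    intro u
    rw [Measure.real, Real.volume_Ioo, ENNReal.toReal_ofReal']
  have hnorm : ∀ u, ∫ v, ‖S.indicator (fun p : ℝ × ℝ => f p.1) (u, v)‖ =
      max (β u - α u) 0 * ‖f u‖ := by
    intro u
    have : (fun v => ‖S.indicator (fun p : ℝ × ℝ => f p.1) (u, v)‖) =
        (Set.Ioo (α u) (β u)).indicator fun _ => ‖f u‖ := by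
      funext v
      rw [congrFun (hsec u) v, norm_indicator_eq_indicator_norm]
    rw [this, integral_indicator measurableSet_Ioo, setIntegral_const, hvol, smul_eq_mul]
  have hI : Integrable (S.indicator fun p : ℝ × ℝ => f p.1) (volume.prod volume) := by
    rw [integrable_prod_iff hg.aestronglyMeasurable]
    refine ⟨Filter.Eventually.of_forall fun u => ?_, ?_⟩
    · rw [hsec u, integrable_indicator_iff measurableSet_Ioo]
      exact integrableOn_const (by simp)
    · simpa only [hnorm] using hint
  refine ⟨(integrable_indicator_iff hSm).mp hI, ?_⟩
  rw [← integral_indicator hSm]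
  change ∫ p, _ ∂(volume.prod volume) = _
  rw [integral_prod _ hI]
  refine integral_congr_ae (Filter.Eventually.of_forall fun u => ?_)
  change ∫ v, S.indicator (fun p : ℝ × ℝ => f p.1) (u, v) = _
  rw [hsec u, integral_indicator measurableSet_Ioo, setIntegral_const, hvol, Complex.real_smul]

/-- The region between the horocycle of height `a₁` at `∞` and the horocycle at `0` that the
inversion `z ↦ -1/z` carries to height `a₂`. -/
def horoBox (a₁ a₂ : ℝ) : Set ℍ :=
  {z | z.im < a₁ ∧ z.im / Complex.normSq (z : ℂ) < a₂}

theorem dilCoord_mem_horoBox {a₁ a₂ : ℝ} (h₁ : 0 < a₁) (h₂ : 0 < a₂) (p : ℝ × ℝ) :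
    dilCoord p ∈ horoBox a₁ a₂ ↔
      -(Real.log a₂ + Real.log (1 + p.1 ^ 2)) < p.2 ∧ p.2 < Real.log a₁ := by
  have hu : 0 < 1 + p.1 ^ 2 := by positivity
  have hv := Real.exp_pos p.2
  have hn : Complex.normSq (dilCoord p : ℂ) = Real.exp p.2 * (Real.exp p.2 * (1 + p.1 ^ 2)) := by
    change Complex.normSq ⟨Real.exp p.2 * p.1, Real.exp p.2⟩ = _
    rw [Complex.normSq_mk]
    ring
  change (Real.exp p.2 < a₁ ∧ Real.exp p.2 / Complex.normSq (dilCoord p : ℂ) < a₂) ↔ _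
  rw [hn, and_comm, ← Real.lt_log_iff_exp_lt h₁, ← Real.log_mul h₂.ne' hu.ne', neg_lt,
    Real.lt_log_iff_exp_lt (by positivity) (x := -p.2), Real.exp_neg]
  refine and_congr ?_ Iff.rfl
  rw [div_lt_iff₀ (by positivity), inv_lt_iff_one_lt_mul₀ hv]
  constructor <;> intro h
  · nlinarith
  · nlinarith

/-- The integral over a box of a function invariant under dilations. -/
theorem integral_horoBox {f : ℝ → ℂ} (hf : Measurable f)
    (hint : Integrable fun u => ‖f u‖)
    (hlog : Integrable fun u => Real.log (1 + u ^ 2) * ‖f u‖)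
    {a₁ a₂ : ℝ} (h₁ : 0 < a₁) (h₂ : 0 < a₂) :
    IntegrableOn (fun z : ℍ => f (z.re / z.im)) (horoBox a₁ a₂) ∧
    ∫ z in horoBox a₁ a₂, f (z.re / z.im) =
      ∫ u, ((max (Real.log a₁ + Real.log a₂ + Real.log (1 + u ^ 2)) 0 : ℝ) : ℂ) * f u := by
  have hpre : dilCoord ⁻¹' horoBox a₁ a₂ =
      {p : ℝ × ℝ | -(Real.log a₂ + Real.log (1 + p.1 ^ 2)) < p.2 ∧ p.2 < Real.log a₁} :=
    Set.ext fun p => dilCoord_mem_horoBox h₁ h₂ p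
  have hcomp : ((fun z : ℍ => f (z.re / z.im)) ∘ dilCoord) = fun p : ℝ × ℝ => f p.1 := by
    funext p
    change f (Real.exp p.2 * p.1 / Real.exp p.2) = f p.1
    rw [mul_div_cancel_left₀ _ (Real.exp_pos _).ne']
  have hm : Measurable fun u : ℝ => Real.log (1 + u ^ 2) := by fun_prop
  have hsum : ∀ u : ℝ, Real.log a₁ - -(Real.log a₂ + Real.log (1 + u ^ 2)) =
      Real.log a₁ + Real.log a₂ + Real.log (1 + u ^ 2) := fun u => by ring
  have key := integral_strip (f := f) (α := fun u => -(Real.log a₂ + Real.log (1 + u ^ 2)))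
    (β := fun _ => Real.log a₁) hf (by fun_prop) measurable_const (by
      refine ((hint.const_mul (|Real.log a₁ + Real.log a₂|)).add hlog).mono'
        (((measurable_const.sub (by fun_prop)).max measurable_const).mul
          hf.norm).aestronglyMeasurable (Filter.Eventually.of_forall fun u => ?_)
      have hl : 0 ≤ Real.log (1 + u ^ 2) := Real.log_nonneg (by nlinarith [sq_nonneg u])
      rw [hsum, Real.norm_of_nonneg (by positivity)]
      simp only [Pi.add_apply]
      rw [← add_mul]
      refine mul_le_mul_of_nonneg_right (max_le ?_ (by positivity)) (norm_nonneg _)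
      linarith [le_abs_self (Real.log a₁ + Real.log a₂)])
  rw [← measurePreserving_dilCoord.integrableOn_comp_preimage measurableEmbedding_dilCoord,
    ← measurePreserving_dilCoord.setIntegral_preimage_emb measurableEmbedding_dilCoord, hpre,
    hcomp]
  refine ⟨key.1, ?_⟩
  have h := key.2
  simp only [hsum] at h
  rw [← h]
  exact congrArg (fun F : ℝ × ℝ → ℂ => ∫ p in _, F p) hcomp

/-! ### The profile of the kernel -/

theorem norm_kfun (s : ℂ) {t : ℝ} (ht : 0 ≤ t) : ‖kfun s t‖ = (1 + t / 4) ^ (-s.re) := by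
  rw [kfun, Complex.norm_cpow_eq_rpow_re_of_pos (by positivity), Complex.neg_re]

theorem measurable_kfun (s : ℂ) : Measurable (kfun s) := by
  unfold kfun
  exact (Complex.measurable_ofReal.comp (by fun_prop)).pow_const _

/-- The kernel `k(z, λz)` of a dilation as a function of `u = cot (arg z)`. -/
def profile (s : ℂ) (κ u : ℝ) : ℂ := kfun s (κ * (1 + u ^ 2))

theorem measurable_profile (s : ℂ) (κ : ℝ) : Measurable (profile s κ) :=
  (measurable_kfun s).comp (by fun_prop)

theorem norm_profile_le {s : ℂ} (hs : 1 < s.re) {κ : ℝ} (hκ : 0 < κ) (u : ℝ) :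
    ‖profile s κ u‖ ≤ (κ / 4) ^ (-s.re) * (1 + u ^ 2) ^ (-s.re) := by
  rw [profile, norm_kfun s (by positivity), ← Real.mul_rpow (by positivity) (by positivity)]
  exact Real.rpow_le_rpow_of_nonpos (by positivity) (by linarith) (by linarith)

theorem integrable_norm_profile {s : ℂ} (hs : 1 < s.re) {κ : ℝ} (hκ : 0 < κ) :
    Integrable fun u => ‖profile s κ u‖ := by
  have h := (integrable_rpow_neg_one_add_norm_sq (E := ℝ) (μ := volume) (r := 2 * s.re)
    (by simp; linarith)).const_mul ((κ / 4) ^ (-s.re))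
  refine h.mono' (measurable_profile s κ).norm.aestronglyMeasurable
    (Filter.Eventually.of_forall fun u => ?_)
  rw [norm_norm, Real.norm_eq_abs, sq_abs, show -(2 * s.re) / 2 = -s.re by ring]
  exact norm_profile_le hs hκ u

theorem integrable_log_mul_norm_profile {s : ℂ} (hs : 1 < s.re) {κ : ℝ} (hκ : 0 < κ) :
    Integrable fun u => Real.log (1 + u ^ 2) * ‖profile s κ u‖ := by
  have h := (integrable_rpow_neg_one_add_norm_sq (E := ℝ) (μ := volume) (r := 2 * s.re - 1)
    (by simp; linarith)).const_mul (2 * (κ / 4) ^ (-s.re))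
  have hm : Measurable fun u : ℝ => Real.log (1 + u ^ 2) := by fun_prop
  refine h.mono' (hm.mul (measurable_profile s κ).norm).aestronglyMeasurable
    (Filter.Eventually.of_forall fun u => ?_)
  have hu : 0 < 1 + u ^ 2 := by positivity
  have hl : 0 ≤ Real.log (1 + u ^ 2) := Real.log_nonneg (by nlinarith [sq_nonneg u])
  have hlog : Real.log (1 + u ^ 2) ≤ 2 * (1 + u ^ 2) ^ (1 / 2 : ℝ) := by
    have := Real.log_le_rpow_div hu.le (ε := 1 / 2) (by norm_num)
    linarith
  rw [Real.norm_of_nonneg (by positivity), Real.norm_eq_abs, sq_abs,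
    show -(2 * s.re - 1) / 2 = 1 / 2 + -s.re by ring, Real.rpow_add hu]
  calc _ ≤ (2 * (1 + u ^ 2) ^ (1 / 2 : ℝ)) * ((κ / 4) ^ (-s.re) * (1 + u ^ 2) ^ (-s.re)) :=
        mul_le_mul hlog (norm_profile_le hs hκ u) (norm_nonneg _) (by positivity)
    _ = _ := by ring

theorem integrable_profile {s : ℂ} (hs : 1 < s.re) {κ : ℝ} (hκ : 0 < κ) :
    Integrable (profile s κ) :=
  (integrable_norm_iff (measurable_profile s κ).aestronglyMeasurable).mp
    (integrable_norm_profile hs hκ)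

theorem integrable_log_mul_profile {s : ℂ} (hs : 1 < s.re) {κ : ℝ} (hκ : 0 < κ) :
    Integrable fun u => ((Real.log (1 + u ^ 2) : ℝ) : ℂ) * profile s κ u := by
  have hm : Measurable fun u : ℝ => Real.log (1 + u ^ 2) := by fun_prop
  have hmm : Measurable fun u : ℝ => ((Real.log (1 + u ^ 2) : ℝ) : ℂ) * profile s κ u :=
    (Complex.measurable_ofReal.comp hm).mul (measurable_profile s κ)
  rw [← integrable_norm_iff hmm.aestronglyMeasurable]
  refine (integrable_log_mul_norm_profile hs hκ).congr (Filter.Eventually.of_forall fun u => ?_)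
  have hl : 0 ≤ Real.log (1 + u ^ 2) := Real.log_nonneg (by nlinarith [sq_nonneg u])
  simp [abs_of_nonneg hl]

/-- The mass of the kernel in the part of the upper half-plane below two shrinking horocycles
tends to zero. -/
theorem tendsto_integral_profile_cut {s : ℂ} (hs : 1 < s.re) {κ : ℝ} (hκ : 0 < κ) {c₁ c₂ : ℝ}
    (h₁ : 0 < c₁) (h₂ : 0 < c₂) :
    Filter.Tendsto (fun Y : ℝ => ∫ u, max (Real.log (c₁ / Y) + Real.log (c₂ / Y) +
      Real.log (1 + u ^ 2)) 0 * ‖profile s κ u‖) Filter.atTop (nhds 0) := by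
  have hm : Measurable fun u : ℝ => Real.log (1 + u ^ 2) := by fun_prop
  have hlim : ∀ u, Filter.Tendsto (fun Y : ℝ => max (Real.log (c₁ / Y) + Real.log (c₂ / Y) +
      Real.log (1 + u ^ 2)) 0 * ‖profile s κ u‖) Filter.atTop (nhds 0) := by
    intro u
    refine tendsto_const_nhds.congr' ?_
    filter_upwards [Filter.eventually_gt_atTop 0, Real.tendsto_log_atTop.eventually_ge_atTop
      (|Real.log c₁| + |Real.log c₂| + Real.log (1 + u ^ 2))] with Y hY hY'
    have hl : 0 ≤ Real.log (1 + u ^ 2) := Real.log_nonneg (by nlinarith [sq_nonneg u])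
    rw [Real.log_div h₁.ne' hY.ne', Real.log_div h₂.ne' hY.ne', max_eq_right, zero_mul]
    have := le_abs_self (Real.log c₁)
    have := le_abs_self (Real.log c₂)
    have := abs_nonneg (Real.log c₁)
    have := abs_nonneg (Real.log c₂)
    linarith
  have := tendsto_integral_filter_of_dominated_convergence (l := Filter.atTop) (μ := volume)
    (F := fun (Y : ℝ) u => max (Real.log (c₁ / Y) + Real.log (c₂ / Y) +
      Real.log (1 + u ^ 2)) 0 * ‖profile s κ u‖) (f := fun _ => 0)
    (fun u => |Real.log c₁ + Real.log c₂| * ‖profile s κ u‖ +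
      Real.log (1 + u ^ 2) * ‖profile s κ u‖)
    (Filter.Eventually.of_forall fun Y =>
      (((measurable_const.add hm).max measurable_const).mul
        (measurable_profile s κ).norm).aestronglyMeasurable)
    (by
      filter_upwards [Filter.eventually_ge_atTop 1] with Y hY
      refine Filter.Eventually.of_forall fun u => ?_
      have hY0 : (0 : ℝ) < Y := by linarith
      have hl : 0 ≤ Real.log (1 + u ^ 2) := Real.log_nonneg (by nlinarith [sq_nonneg u])
      have hlY := Real.log_nonneg hY
      rw [Real.norm_of_nonneg (by positivity), ← add_mul]
      refine mul_le_mul_of_nonneg_right (max_le ?_ (by positivity)) (norm_nonneg _)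
      rw [Real.log_div h₁.ne' hY0.ne', Real.log_div h₂.ne' hY0.ne']
      linarith [le_abs_self (Real.log c₁ + Real.log c₂)])
    (((integrable_norm_profile hs hκ).const_mul _).add (integrable_log_mul_norm_profile hs hκ))
    (Filter.Eventually.of_forall hlim)
  simpa using this

/-- Asymptotics of the integral of the kernel of a dilation over sets that agree with the region
between two receding horocycles at the fixed points, up to a part that stays close to the
real axis. -/
theorem tendsto_integral_between_horocycles {s : ℂ} (hs : 1 < s.re) {κ : ℝ} (hκ : 0 < κ)
    {a₁ a₂ c₁ c₂ : ℝ} (ha₁ : 0 < a₁) (ha₂ : 0 < a₂) (hc₁ : 0 < c₁) (hc₂ : 0 < c₂)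
    {S : ℝ → Set ℍ} (hSm : ∀ Y, 0 < Y → MeasurableSet (S Y))
    (hS : ∀ Y, 0 < Y → S Y ⊆ horoBox (a₁ * Y) (a₂ * Y))
    (hS' : ∀ Y, 0 < Y → horoBox (a₁ * Y) (a₂ * Y) \ S Y ⊆ horoBox (c₁ / Y) (c₂ / Y)) :
    (∀ Y, 0 < Y → IntegrableOn (fun z : ℍ => profile s κ (z.re / z.im)) (S Y)) ∧
    Filter.Tendsto (fun Y : ℝ => (∫ z in S Y, profile s κ (z.re / z.im)) -
      (((2 * Real.log Y + Real.log (a₁ * a₂) : ℝ) : ℂ) * (∫ u, profile s κ u) +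
        ∫ u, ((Real.log (1 + u ^ 2) : ℝ) : ℂ) * profile s κ u)) Filter.atTop (nhds 0) := by
  have hbox : ∀ {b₁ b₂ : ℝ}, 0 < b₁ → 0 < b₂ → _ := fun {b₁ b₂} h₁ h₂ =>
    integral_horoBox (measurable_profile s κ) (integrable_norm_profile hs hκ)
      (integrable_log_mul_norm_profile hs hκ) (a₁ := b₁) (a₂ := b₂) h₁ h₂
  have hboxn : ∀ {b₁ b₂ : ℝ}, 0 < b₁ → 0 < b₂ → _ := fun {b₁ b₂} h₁ h₂ =>
    integral_horoBox (f := fun u => ((‖profile s κ u‖ : ℝ) : ℂ))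
      (Complex.measurable_ofReal.comp (measurable_profile s κ).norm)
      (by simpa using integrable_norm_profile hs hκ)
      (by simpa using integrable_log_mul_norm_profile hs hκ) (a₁ := b₁) (a₂ := b₂) h₁ h₂
  refine ⟨fun Y hY => (hbox (by positivity) (by positivity)).1.mono_set (hS Y hY), ?_⟩
  refine squeeze_zero_norm' ?_ (tendsto_integral_profile_cut hs hκ hc₁ hc₂)
  filter_upwards [Filter.eventually_ge_atTop 1, Real.tendsto_log_atTop.eventually_ge_atTop
      (|Real.log (a₁ * a₂)|)] with Y hY1 hlogY
  have hY : 0 < Y := by linarith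
  obtain ⟨hI, hE⟩ := hbox (b₁ := a₁ * Y) (b₂ := a₂ * Y) (by positivity) (by positivity)
  have hmain : ∫ z in horoBox (a₁ * Y) (a₂ * Y), profile s κ (z.re / z.im) =
      ((2 * Real.log Y + Real.log (a₁ * a₂) : ℝ) : ℂ) * (∫ u, profile s κ u) +
        ∫ u, ((Real.log (1 + u ^ 2) : ℝ) : ℂ) * profile s κ u := by
    rw [hE, ← integral_const_mul, ← integral_add ((integrable_profile hs hκ).const_mul _)
      (integrable_log_mul_profile hs hκ)]
    refine integral_congr_ae (Filter.Eventually.of_forall fun u => ?_)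
    have hl : 0 ≤ Real.log (1 + u ^ 2) := Real.log_nonneg (by nlinarith [sq_nonneg u])
    have hlY := Real.log_nonneg hY1
    have hc := neg_abs_le (Real.log (a₁ * a₂))
    have : Real.log (a₁ * Y) + Real.log (a₂ * Y) + Real.log (1 + u ^ 2) =
        2 * Real.log Y + Real.log (a₁ * a₂) + Real.log (1 + u ^ 2) := by
      rw [Real.log_mul ha₁.ne' hY.ne', Real.log_mul ha₂.ne' hY.ne', Real.log_mul ha₁.ne' ha₂.ne']
      ring
    beta_reduce
    rw [this, max_eq_left (by linarith), ← add_mul]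
    push_cast
    ring
  rw [← hmain]
  obtain ⟨hIn, hEn⟩ := hboxn (b₁ := c₁ / Y) (b₂ := c₂ / Y) (by positivity) (by positivity)
  have hdiff := setIntegral_sdiff (hSm Y hY) hI (hS Y hY)
  rw [norm_sub_rev, ← hdiff]
  have hF : IntegrableOn (fun z : ℍ => ‖profile s κ (z.re / z.im)‖)
      (horoBox (c₁ / Y) (c₂ / Y)) := by
    have := hIn.norm
    rw [IntegrableOn]
    simpa using this
  calc _ ≤ ∫ z in horoBox (a₁ * Y) (a₂ * Y) \ S Y, ‖profile s κ (z.re / z.im)‖ :=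
        norm_integral_le_integral_norm _
    _ ≤ ∫ z in horoBox (c₁ / Y) (c₂ / Y), ‖profile s κ (z.re / z.im)‖ :=
        setIntegral_mono_set hF (Filter.Eventually.of_forall fun _ => norm_nonneg _)
          (Filter.Eventually.of_forall (hS' Y hY))
    _ = _ := by
        rw [← Complex.ofReal_inj, ← integral_complex_ofReal, ← integral_complex_ofReal, hEn]
        refine integral_congr_ae (Filter.Eventually.of_forall fun u => ?_)
        beta_reduce
        push_cast
        rfl

/-! ### The integral transforms of the kernel -/

/-- The substitution `t = 1 + u²`. -/
theorem integral_comp_one_add_sq {φ : ℝ → ℂ} (h : Integrable fun u : ℝ => φ (1 + u ^ 2)) :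
    IntegrableOn (fun t => φ t * ((1 / √(t - 1) : ℝ) : ℂ)) (Set.Ioi 1) ∧
    ∫ u, φ (1 + u ^ 2) = ∫ t in Set.Ioi (1 : ℝ), φ t * ((1 / √(t - 1) : ℝ) : ℂ) := by
  have himg : (fun u : ℝ => 1 + u ^ 2) '' Set.Ioi 0 = Set.Ioi 1 := by
    ext t
    simp only [Set.mem_image, Set.mem_Ioi]
    constructor
    · rintro ⟨u, hu, rfl⟩
      nlinarith
    · intro ht
      exact ⟨√(t - 1), Real.sqrt_pos.mpr (by linarith), by rw [Real.sq_sqrt (by linarith)]; ring⟩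
  have hder : ∀ u ∈ Set.Ioi (0 : ℝ),
      HasDerivWithinAt (fun u : ℝ => 1 + u ^ 2) (2 * u) (Set.Ioi 0) u := by
    intro u _
    have := ((hasDerivAt_pow 2 u).const_add 1).hasDerivWithinAt (s := Set.Ioi 0)
    simpa using this
  have hinj : Set.InjOn (fun u : ℝ => 1 + u ^ 2) (Set.Ioi 0) := by
    intro u hu v hv huv
    exact (sq_eq_sq₀ (le_of_lt hu) (le_of_lt hv)).mp (add_left_cancel huv)
  have hcongr : Set.EqOn (fun u : ℝ => |2 * u| •
      (φ (1 + u ^ 2) * ((1 / √(1 + u ^ 2 - 1) : ℝ) : ℂ))) (fun u => 2 * φ (1 + u ^ 2))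
      (Set.Ioi 0) := by
    intro u (hu : 0 < u)
    have hu' : (u : ℂ) ≠ 0 := by exact_mod_cast hu.ne'
    beta_reduce
    rw [add_sub_cancel_left, Real.sqrt_sq hu.le, abs_of_pos (by positivity), Complex.real_smul]
    push_cast
    field_simp
  have hI := integrableOn_image_iff_integrableOn_abs_deriv_smul measurableSet_Ioi hder hinj
    (fun t => φ t * ((1 / √(t - 1) : ℝ) : ℂ))
  have hE := integral_image_eq_integral_abs_deriv_smul measurableSet_Ioi hder hinj
    (fun t => φ t * ((1 / √(t - 1) : ℝ) : ℂ))
  rw [himg] at hI hE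
  rw [integrableOn_congr_fun hcongr measurableSet_Ioi] at hI
  rw [setIntegral_congr_fun measurableSet_Ioi hcongr, integral_const_mul] at hE
  refine ⟨hI.mpr (h.integrableOn.const_mul 2), ?_⟩
  rw [hE, ← intervalIntegral.integral_Iic_add_Ioi (b := 0) h.integrableOn h.integrableOn]
  have hneg := integral_comp_neg_Ioi (0 : ℝ) (fun u : ℝ => φ (1 + u ^ 2))
  simp only [even_two, Even.neg_pow, neg_zero] at hneg
  rw [← hneg]
  ring

theorem sqrt_mul_integral_profile {s : ℂ} (hs : 1 < s.re) {κ : ℝ} (hκ : 0 < κ) :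
    ((√κ : ℝ) : ℂ) * ∫ u, profile s κ u =
      ∫ t in Set.Ioi κ, kfun s t / ((√(t - κ) : ℝ) : ℂ) := by
  have h := (integral_comp_one_add_sq (φ := fun t => kfun s (κ * t))
    (integrable_profile hs hκ)).2
  have h' := integral_comp_mul_left_Ioi' (fun t => kfun s t / ((√(t - κ) : ℝ) : ℂ)) 1 hκ
  rw [mul_one] at h'
  have hκ' : ((√κ : ℝ) : ℂ) ≠ 0 := by exact_mod_cast (Real.sqrt_pos.mpr hκ).ne'
  have hsq : (κ : ℂ) = ((√κ : ℝ) : ℂ) * ((√κ : ℝ) : ℂ) := by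
    rw [← Complex.ofReal_mul, Real.mul_self_sqrt hκ.le]
  have h₂ : ∫ u, profile s κ u = _ := h
  rw [← h', Complex.real_smul, h₂, ← integral_const_mul, ← integral_const_mul]
  refine setIntegral_congr_fun measurableSet_Ioi fun t (ht : 1 < t) => ?_
  have hr : √(κ * t - κ) = √κ * √(t - 1) := by
    rw [← Real.sqrt_mul hκ.le]; congr 1; ring
  have ht' : ((√(t - 1) : ℝ) : ℂ) ≠ 0 := by
    exact_mod_cast (Real.sqrt_pos.mpr (by linarith)).ne'
  rw [hr]
  rw [hsq]
  push_cast
  field_simp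

theorem integral_profile_eq_gfun {s : ℂ} (hs : 1 < s.re) {n a d : ℕ} (ha : 0 < a) (hd : 0 < d)
    (hne : a ≠ d) (had : a * d = n) :
    ∫ u, profile s (((a : ℝ) - d) ^ 2 / n) u =
      ((√(n : ℝ) : ℝ) : ℂ) * gfun s (Real.log ((a : ℝ) / d)) / ((|(a : ℝ) - d| : ℝ) : ℂ) := by
  have ha' : (0 : ℝ) < a := by exact_mod_cast ha
  have hd' : (0 : ℝ) < d := by exact_mod_cast hd
  have hn' : (0 : ℝ) < n := by rw [← had]; push_cast; positivity
  have hsub : (a : ℝ) - d ≠ 0 := sub_ne_zero.mpr (by exact_mod_cast hne)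
  have hκ : 0 < ((a : ℝ) - d) ^ 2 / n := by positivity
  have hw : Real.exp (Real.log ((a : ℝ) / d)) + Real.exp (-Real.log ((a : ℝ) / d)) - 2 =
      ((a : ℝ) - d) ^ 2 / n := by
    rw [Real.exp_neg, Real.exp_log (by positivity), ← had]
    push_cast
    field_simp
    ring
  rw [gfun, hw, ← sqrt_mul_integral_profile hs hκ, Real.sqrt_div (sq_nonneg _), Real.sqrt_sq_eq_abs]
  have h1 : ((√(n : ℝ) : ℝ) : ℂ) ≠ 0 := by exact_mod_cast (Real.sqrt_pos.mpr hn').ne'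
  have h2 : ((|(a : ℝ) - d| : ℝ) : ℂ) ≠ 0 := by exact_mod_cast (abs_pos.mpr hsub).ne'
  push_cast
  field_simp

theorem integral_log_profile {s : ℂ} (hs : 1 < s.re) {n a d : ℕ} (hn : 0 < n) (hne : a ≠ d) :
    IntegrableOn (tailIntegrand s n a d) (Set.Ioi 1) ∧
    ∫ u, ((Real.log (1 + u ^ 2) : ℝ) : ℂ) * profile s (((a : ℝ) - d) ^ 2 / n) u =
      ∫ t in Set.Ioi (1 : ℝ), tailIntegrand s n a d t := by
  have hn' : (0 : ℝ) < n := by exact_mod_cast hn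
  have hsub : (a : ℝ) - d ≠ 0 := sub_ne_zero.mpr (by exact_mod_cast hne)
  have hκ : 0 < ((a : ℝ) - d) ^ 2 / n := by positivity
  set κ : ℝ := ((a : ℝ) - d) ^ 2 / n with hκdef
  obtain ⟨φ, hφ⟩ : ∃ φ : ℝ → ℂ, ∀ t, φ t = ((Real.log t : ℝ) : ℂ) * kfun s (κ * t) :=
    ⟨_, fun _ => rfl⟩
  have hprof : ∀ u : ℝ, ((Real.log (1 + u ^ 2) : ℝ) : ℂ) * profile s κ u = φ (1 + u ^ 2) :=
    fun u => (hφ _).symm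
  have heq : ∀ t : ℝ, φ t * ((1 / √(t - 1) : ℝ) : ℂ) = tailIntegrand s n a d t := by
    intro t
    rw [tailIntegrand, ← hκdef, hφ]
    push_cast
    ring
  have hint := integrable_log_mul_profile hs hκ
  simp only [hprof] at hint ⊢
  have h := integral_comp_one_add_sq hint
  simp only [heq] at h
  exact h

/-! ### Normalized heights at the cusps -/

theorem mem_Gam_iff {N : ℕ} {γ : SL(2, ℝ)} :
    γ ∈ Gam N ↔ ∃ A B C D : ℤ, A * D - B * C = 1 ∧ (N : ℤ) ∣ C ∧
      (γ : Matrix (Fin 2) (Fin 2) ℝ) = !![(A : ℝ), (B : ℝ); (C : ℝ), (D : ℝ)] := by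
  rw [Gam, Subgroup.mem_map]
  constructor
  · rintro ⟨δ, hδ, rfl⟩
    rw [CongruenceSubgroup.Gamma0_mem, ZMod.intCast_zmod_eq_zero_iff_dvd] at hδ
    refine ⟨δ 0 0, δ 0 1, δ 1 0, δ 1 1, ?_, hδ, ?_⟩
    · rw [← Matrix.det_fin_two]; exact δ.2
    · ext i j
      fin_cases i <;> fin_cases j <;> simp
  · rintro ⟨A, B, C, D, hdet, hC, h⟩
    obtain ⟨δ, hδ⟩ : ∃ δ : SL(2, ℤ), (δ : Matrix (Fin 2) (Fin 2) ℤ) = !![A, B; C, D] :=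
      ⟨⟨!![A, B; C, D], by rw [Matrix.det_fin_two_of]; exact hdet⟩, rfl⟩
    refine ⟨δ, ?_, ?_⟩
    · rw [CongruenceSubgroup.Gamma0_mem, ZMod.intCast_zmod_eq_zero_iff_dvd, hδ]
      exact hC
    · apply Subtype.ext
      rw [h]
      ext i j
      fin_cases i <;> fin_cases j <;> simp [hδ]

theorem coe_SL_smul (g : SL(2, ℝ)) (z : ℍ) :
    ((g • z : ℍ) : ℂ) = ((g 0 0 : ℝ) * (z : ℂ) + (g 0 1 : ℝ)) /
      ((g 1 0 : ℝ) * (z : ℂ) + (g 1 1 : ℝ)) := by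
  rw [UpperHalfPlane.coe_specialLinearGroup_apply]
  simp

theorem im_SL_smul (g : SL(2, ℝ)) (z : ℍ) :
    (g • z).im = z.im / Complex.normSq ((g 1 0 : ℝ) * (z : ℂ) + (g 1 1 : ℝ)) := by
  change (UpperHalfPlane.im (Matrix.SpecialLinearGroup.mapGL ℝ g • z)) = _
  rw [UpperHalfPlane.im_smul_eq_div_normSq]
  simp [UpperHalfPlane.denom]

theorem SL_denom_ne_zero (g : SL(2, ℝ)) (z : ℍ) :
    ((g 1 0 : ℝ) * (z : ℂ) + (g 1 1 : ℝ)) ≠ 0 := by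
  have := UpperHalfPlane.denom_ne_zero (Matrix.SpecialLinearGroup.mapGL ℝ g) z
  simpa [UpperHalfPlane.denom] using this

theorem im_SL_inv_smul (g : SL(2, ℝ)) (z : ℍ) :
    (g⁻¹ • z).im = z.im / Complex.normSq ((g 0 0 : ℝ) - (g 1 0 : ℝ) * (z : ℂ)) := by
  rw [im_SL_smul, Matrix.SpecialLinearGroup.SL2_inv_expl]
  congr 2
  simp
  ring

/-- The width of the cusp `p/q` of `Γ₀(N)`. -/
def width (N : ℕ) (q : ℤ) : ℕ := N / Int.gcd (q ^ 2) N

theorem width_mul_gcd (N : ℕ) (q : ℤ) : width N q * Int.gcd (q ^ 2) N = N :=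
  Nat.div_mul_cancel (Int.natCast_dvd_natCast.mp (Int.gcd_dvd_right _ _))

theorem width_pos {N : ℕ} (hN : N ≠ 0) (q : ℤ) : 0 < width N q :=
  Nat.pos_of_ne_zero fun h => hN (by rw [← width_mul_gcd N q, h, zero_mul])

theorem dvd_sq_mul_width (N : ℕ) (q : ℤ) : (N : ℤ) ∣ q ^ 2 * width N q := by
  obtain ⟨k, hk⟩ := Int.gcd_dvd_left (q ^ 2) (N : ℤ)
  refine ⟨k, ?_⟩
  have h : ((width N q : ℕ) : ℤ) * (Int.gcd (q ^ 2) N : ℤ) = N := by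
    exact_mod_cast width_mul_gcd N q
  rw [← h]
  nth_rw 1 [hk]
  ring

theorem width_dvd {N : ℕ} (hN : N ≠ 0) {q r : ℤ} (h : (N : ℤ) ∣ r * q ^ 2) :
    (width N q : ℤ) ∣ r := by
  have hg : 0 < Int.gcd (q ^ 2) N := Int.gcd_pos_of_ne_zero_right _ (by exact_mod_cast hN)
  obtain ⟨k, hk⟩ := Int.gcd_dvd_left (q ^ 2) (N : ℤ)
  have hw : ((width N q : ℕ) : ℤ) * (Int.gcd (q ^ 2) N : ℤ) = N := by
    exact_mod_cast width_mul_gcd N q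
  have hg' : (Int.gcd (q ^ 2) N : ℤ) ≠ 0 := by exact_mod_cast hg.ne'
  have hcop : IsCoprime (width N q : ℤ) k := by
    obtain ⟨u, v, huv⟩ : ∃ u v, q ^ 2 * u + (N : ℤ) * v = Int.gcd (q ^ 2) N :=
      ⟨_, _, (Int.gcd_eq_gcd_ab _ _).symm⟩
    refine ⟨v, u, mul_left_cancel₀ hg' ?_⟩
    linear_combination huv - u * hk + v * hw
  obtain ⟨j, hj⟩ := h
  have h1 : (width N q : ℤ) ∣ r * k :=
    ⟨j, mul_left_cancel₀ hg' (by linear_combination hj - r * hk - j * hw)⟩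
  exact hcop.dvd_of_dvd_mul_right h1

/-- The width is invariant under `Γ₀(N)`. -/
theorem width_eq_of_dvd {N : ℕ} {D q Q : ℤ} (hD : IsCoprime D N) (h : (N : ℤ) ∣ Q - D * q) :
    width N Q = width N q := by
  have hg : Int.gcd (Q ^ 2) N = Int.gcd (q ^ 2) N := by
    obtain ⟨k, hk⟩ := h
    have hQ : Q ^ 2 = D ^ 2 * q ^ 2 + N * (k * (Q + D * q)) := by
      linear_combination (Q + D * q) * hk
    apply Nat.dvd_antisymm
    · have h1 := Int.gcd_dvd_left (Q ^ 2) (N : ℤ)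
      have h2 := Int.gcd_dvd_right (Q ^ 2) (N : ℤ)
      refine Int.natCast_dvd_natCast.mp (Int.dvd_coe_gcd ?_ h2)
      have h3 : (Int.gcd (Q ^ 2) N : ℤ) ∣ D ^ 2 * q ^ 2 := by
        rw [show D ^ 2 * q ^ 2 = Q ^ 2 - N * (k * (Q + D * q)) by rw [hQ]; ring]
        exact dvd_sub h1 (h2.mul_right _)
      exact ((hD.pow_left (m := 2)).symm.of_isCoprime_of_dvd_left h2).dvd_of_dvd_mul_left h3
    · have h1 := Int.gcd_dvd_left (q ^ 2) (N : ℤ)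
      have h2 := Int.gcd_dvd_right (q ^ 2) (N : ℤ)
      refine Int.natCast_dvd_natCast.mp (Int.dvd_coe_gcd ?_ h2)
      rw [hQ]
      exact dvd_add (h1.mul_left _) (h2.mul_right _)
  rw [width, width, hg]

/-- The imaginary part of `z` in a coordinate in which the cusp `p/q` of `Γ₀(N)` is `∞` with
width one. -/
def cuspHeight (N : ℕ) (p q : ℤ) (z : ℍ) : ℝ :=
  z.im / (width N q * Complex.normSq ((p : ℂ) - (q : ℂ) * (z : ℂ)))

/-- The complement of the horoballs of height `Y` at all the cusps. -/
def thickPart (N : ℕ) (Y : ℝ) : Set ℍ :=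
  {z | ∀ p q : ℤ, IsCoprime p q → cuspHeight N p q z < Y}

theorem cuspHeight_smul {N : ℕ} {A B C D : ℤ} (hdet : A * D - B * C = 1) (hC : (N : ℤ) ∣ C)
    {γ : SL(2, ℝ)}
    (hγ : (γ : Matrix (Fin 2) (Fin 2) ℝ) = !![(A : ℝ), (B : ℝ); (C : ℝ), (D : ℝ)])
    (p q : ℤ) (z : ℍ) :
    cuspHeight N (A * p + B * q) (C * p + D * q) (γ • z) = cuspHeight N p q z := by
  obtain ⟨k, hk⟩ := hC
  have hw : width N (C * p + D * q) = width N q := by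
    refine width_eq_of_dvd (D := D) ⟨A, -(B * k), ?_⟩ ⟨k * p, ?_⟩
    · linear_combination hdet + B * hk
    · rw [hk]; ring
  have h00 : γ 0 0 = A := by simp [hγ]
  have h01 : γ 0 1 = B := by simp [hγ]
  have h10 : γ 1 0 = C := by simp [hγ]
  have h11 : γ 1 1 = D := by simp [hγ]
  have hden := SL_denom_ne_zero γ z
  have hc := coe_SL_smul γ z
  have him := im_SL_smul γ z
  rw [h10, h11] at hden him hc
  rw [h00, h01] at hc
  have hdet' : (A : ℂ) * D - B * C = 1 := by exact_mod_cast hdet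
  push_cast at hden hc
  have hE : ((A * p + B * q : ℤ) : ℂ) - ((C * p + D * q : ℤ) : ℂ) * ((γ • z : ℍ) : ℂ) =
      ((p : ℂ) - q * z) / (C * z + D) := by
    rw [hc]
    push_cast
    field_simp
    linear_combination ((p : ℂ) - q * z) * hdet'
  have hn : Complex.normSq ((C : ℂ) * z + D) ≠ 0 := by simpa using hden
  push_cast at him
  rw [cuspHeight, cuspHeight, hw, hE, him, Complex.normSq_div]
  field_simp

theorem smul_mem_thickPart {N : ℕ} {Y : ℝ} {γ : SL(2, ℝ)} (hγ : γ ∈ Gam N) {z : ℍ}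
    (hz : z ∈ thickPart N Y) : γ • z ∈ thickPart N Y := by
  obtain ⟨A, B, C, D, hdet, hC, h⟩ := mem_Gam_iff.mp hγ
  intro p q hpq
  have key := cuspHeight_smul hdet hC h (D * p - B * q) (A * q - C * p) z
  have e1 : A * (D * p - B * q) + B * (A * q - C * p) = p := by linear_combination p * hdet
  have e2 : C * (D * p - B * q) + D * (A * q - C * p) = q := by linear_combination q * hdet
  rw [e1, e2] at key
  rw [key]
  apply hz
  obtain ⟨u, v, huv⟩ := hpq
  refine ⟨u * A + v * C, u * B + v * D, ?_⟩
  linear_combination huv + (u * p + v * q) * hdet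

theorem cuspOf_eq_iff (g h : SL(2, ℝ)) :
    cuspOf g = cuspOf h ↔ g 0 0 * h 1 0 = g 1 0 * h 0 0 := by
  have hg : g 0 0 * g 1 1 - g 0 1 * g 1 0 = 1 := by rw [← Matrix.det_fin_two]; exact g.2
  have hh : h 0 0 * h 1 1 - h 0 1 * h 1 0 = 1 := by rw [← Matrix.det_fin_two]; exact h.2
  rw [cuspOf, cuspOf, OnePoint.smul_infty_eq_ite, OnePoint.smul_infty_eq_ite]
  simp only [Matrix.SpecialLinearGroup.mapGL_coe_matrix, Matrix.SpecialLinearGroup.map_apply_coe,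
    RingHom.mapMatrix_apply, Matrix.map_apply, Algebra.algebraMap_self, RingHom.id_apply]
  by_cases h1 : g 1 0 = 0 <;> by_cases h2 : h 1 0 = 0
  · simp [h1, h2]
  · have : g 0 0 ≠ 0 := by rintro h0; simp [h0, h1] at hg
    simp [h1, h2, this]
  · have : h 0 0 ≠ 0 := by rintro h0; simp [h0, h2] at hh
    simp [h1, h2, this]
  · simp only [h1, h2, if_false, OnePoint.coe_eq_coe]
    rw [div_eq_div_iff h1 h2, mul_comm (h 0 0)]

theorem smul_cuspOf (γ g : SL(2, ℝ)) :
    Matrix.SpecialLinearGroup.mapGL ℝ γ • cuspOf g = cuspOf (γ * g) := by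
  rw [cuspOf, cuspOf, map_mul, mul_smul]

/-- If `g ∞ = p/q`, the first column of `g` is
a nonzero multiple of `(p, q)`. -/
theorem exists_col_eq_of_cuspOf_eq {g : SL(2, ℝ)} {τ : SL(2, ℤ)}
    (h : cuspOf g = cuspOf (Matrix.SpecialLinearGroup.map (Int.castRingHom ℝ) τ)) :
    ∃ t : ℝ, t ≠ 0 ∧ g 0 0 = t * τ 0 0 ∧ g 1 0 = t * τ 1 0 := by
  rw [cuspOf_eq_iff] at h
  simp only [Matrix.SpecialLinearGroup.map_apply_coe, RingHom.mapMatrix_apply, Matrix.map_apply,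
    Int.coe_castRingHom] at h
  have hτ : (τ 0 0 : ℝ) * τ 1 1 - τ 0 1 * τ 1 0 = 1 := by
    have : τ 0 0 * τ 1 1 - τ 0 1 * τ 1 0 = 1 := by rw [← Matrix.det_fin_two]; exact τ.2
    exact_mod_cast this
  have hg : g 0 0 * g 1 1 - g 0 1 * g 1 0 = 1 := by rw [← Matrix.det_fin_two]; exact g.2
  have h0 : g 0 0 = (τ 1 1 * g 0 0 - τ 0 1 * g 1 0) * τ 0 0 := by
    linear_combination -(g 0 0) * hτ - τ 0 1 * h
  have h1 : g 1 0 = (τ 1 1 * g 0 0 - τ 0 1 * g 1 0) * τ 1 0 := by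
    linear_combination -(g 1 0) * hτ - τ 1 1 * h
  refine ⟨_, ?_, h0, h1⟩
  intro ht
  rw [ht, zero_mul] at h0 h1
  rw [h0, h1] at hg
  norm_num at hg

/-- A scaling matrix of the cusp `p/q` is determined up to translations: its imaginary part
is the normalized height. -/
theorem im_inv_smul_eq_cuspHeight {N : ℕ} (hN : N ≠ 0) {g : SL(2, ℝ)} {τ : SL(2, ℤ)}
    (hcusp : cuspOf g = cuspOf (Matrix.SpecialLinearGroup.map (Int.castRingHom ℝ) τ))
    (hstab : ∀ γ : SL(2, ℝ),
      (γ ∈ Gam N ∧ Matrix.SpecialLinearGroup.mapGL ℝ γ • cuspOf g = cuspOf g) ↔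
        ∃ m : ℤ, ((g⁻¹ * γ * g : SL(2, ℝ)) : Matrix (Fin 2) (Fin 2) ℝ) = !![1, (m : ℝ); 0, 1] ∨
          ((g⁻¹ * γ * g : SL(2, ℝ)) : Matrix (Fin 2) (Fin 2) ℝ) = -!![1, (m : ℝ); 0, 1])
    (z : ℍ) : (g⁻¹ • z).im = cuspHeight N (τ 0 0) (τ 1 0) z := by
  obtain ⟨t, ht, h00, h10⟩ := exists_col_eq_of_cuspOf_eq hcusp
  set p := τ 0 0 with hp
  set q := τ 1 0 with hq
  have hτ : p * τ 1 1 - τ 0 1 * q = 1 := by rw [hp, hq, ← Matrix.det_fin_two]; exact τ.2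
  have hτ' : (p : ℝ) * τ 1 1 - τ 0 1 * q = 1 := by exact_mod_cast hτ
  have hg : g 0 0 * g 1 1 - g 0 1 * g 1 0 = 1 := by rw [← Matrix.det_fin_two]; exact g.2
  rw [h00, h10] at hg
  -- the generator of the stabilizer of `p/q` in `Γ₀(N)` forces `h = m t²` with `m` integral
  obtain ⟨m, hm⟩ : ∃ m : ℤ, (width N q : ℝ) = m * t ^ 2 := by
    obtain ⟨γ, hγ⟩ : ∃ γ : SL(2, ℝ), (γ : Matrix (Fin 2) (Fin 2) ℝ) =
        !![1 - (p * q * width N q : ℝ), p ^ 2 * width N q; -(q ^ 2 * width N q : ℝ),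
          1 + p * q * width N q] :=
      ⟨⟨_, by rw [Matrix.det_fin_two_of]; ring⟩, rfl⟩
    have hγN : γ ∈ Gam N := by
      refine mem_Gam_iff.mpr ⟨1 - p * q * width N q, p ^ 2 * width N q, -(q ^ 2 * width N q),
        1 + p * q * width N q, by ring, (dvd_sq_mul_width N q).neg_right, ?_⟩
      rw [hγ]
      push_cast
      rfl
    have hfix : Matrix.SpecialLinearGroup.mapGL ℝ γ • cuspOf g = cuspOf g := by
      rw [smul_cuspOf, cuspOf_eq_iff]
      simp only [Matrix.SpecialLinearGroup.coe_mul, Matrix.mul_apply, Fin.sum_univ_two, hγ, h00,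
        h10, Matrix.of_apply, Matrix.cons_val', Matrix.cons_val_zero, Matrix.cons_val_one,
        Matrix.cons_val_fin_one]
      ring
    obtain ⟨m, hm⟩ := (hstab γ).mp ⟨hγN, hfix⟩
    have hmul : (γ : Matrix (Fin 2) (Fin 2) ℝ) * (g : Matrix (Fin 2) (Fin 2) ℝ) =
        (g : Matrix (Fin 2) (Fin 2) ℝ) *
          ((g⁻¹ * γ * g : SL(2, ℝ)) : Matrix (Fin 2) (Fin 2) ℝ) := by
      have hc : γ * g = g * (g⁻¹ * γ * g) := by group
      rw [← Matrix.SpecialLinearGroup.coe_mul, ← Matrix.SpecialLinearGroup.coe_mul, ← hc]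
    rcases hm with hm | hm
    · refine ⟨m, ?_⟩
      rw [hm, hγ] at hmul
      have e0 := congrFun (congrFun hmul 0) 1
      have e1 := congrFun (congrFun hmul 1) 1
      simp [Matrix.mul_apply, Fin.sum_univ_two, h00, h10] at e0 e1
      have k0 : (width N q : ℝ) * p = m * t ^ 2 * p := by
        linear_combination t * e0 - p * width N q * hg
      have k1 : (width N q : ℝ) * q = m * t ^ 2 * q := by
        linear_combination t * e1 - q * width N q * hg
      linear_combination τ 1 1 * k0 - τ 0 1 * k1 + (m * t ^ 2 - width N q) * hτ'
    · exfalso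
      rw [hm, hγ] at hmul
      have e0 := congrFun (congrFun hmul 0) 0
      have e1 := congrFun (congrFun hmul 1) 0
      simp [Matrix.mul_apply, Fin.sum_univ_two, h00, h10] at e0 e1
      have k0 : t * p = 0 := by linear_combination e0 / 2
      have k1 : t * q = 0 := by linear_combination e1 / 2
      rw [k0, k1] at hg
      norm_num at hg
  -- the conjugate of the unit translation is integral of level `N`, so `t²` is a multiple of `h`
  obtain ⟨r, hr, hrdvd⟩ : ∃ r : ℤ, t ^ 2 = r ∧ (width N q : ℤ) ∣ r := by
    obtain ⟨u, hu⟩ : ∃ u : SL(2, ℝ), (u : Matrix (Fin 2) (Fin 2) ℝ) = !![1, 1; 0, 1] :=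
      ⟨⟨_, by rw [Matrix.det_fin_two_of]; ring⟩, rfl⟩
    have hconj : g⁻¹ * (g * u * g⁻¹) * g = u := by group
    obtain ⟨hmem, -⟩ := (hstab (g * u * g⁻¹)).mpr ⟨1, Or.inl (by rw [hconj, hu]; simp)⟩
    obtain ⟨A, B, C, D, -, hC, hM⟩ := mem_Gam_iff.mp hmem
    have hmul : ((g * u * g⁻¹ : SL(2, ℝ)) : Matrix (Fin 2) (Fin 2) ℝ) *
        (g : Matrix (Fin 2) (Fin 2) ℝ) =
        (g : Matrix (Fin 2) (Fin 2) ℝ) * (u : Matrix (Fin 2) (Fin 2) ℝ) := by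
      have hc : g * u * g⁻¹ * g = g * u := by group
      rw [← Matrix.SpecialLinearGroup.coe_mul, ← Matrix.SpecialLinearGroup.coe_mul, hc]
    rw [hM, hu] at hmul
    have e00 := congrFun (congrFun hmul 0) 0
    have e01 := congrFun (congrFun hmul 0) 1
    have e10 := congrFun (congrFun hmul 1) 0
    have e11 := congrFun (congrFun hmul 1) 1
    simp [Matrix.mul_apply, Fin.sum_univ_two, h00, h10] at e00 e01 e10 e11
    have hB : (B : ℝ) = t ^ 2 * p ^ 2 := by
      linear_combination (t * p) * e01 - g 0 1 * e00 - B * hg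
    have hC' : (C : ℝ) = -(t ^ 2 * q ^ 2) := by
      linear_combination g 1 1 * e10 - (t * q) * e11 - C * hg
    have hD : (D : ℝ) = 1 + t ^ 2 * p * q := by
      linear_combination (t * p) * e11 - g 0 1 * e10 - (D - 1) * hg
    have hr : t ^ 2 = ((B * τ 1 1 ^ 2 - 2 * (D - 1) * τ 1 1 * τ 0 1 - C * τ 0 1 ^ 2 : ℤ) : ℝ) := by
      push_cast
      rw [hB, hC', hD]
      linear_combination -(t ^ 2) * (p * τ 1 1 - τ 0 1 * q + 1) * hτ'
    refine ⟨_, hr, width_dvd hN ?_⟩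
    have : (C : ℝ) = ((-((B * τ 1 1 ^ 2 - 2 * (D - 1) * τ 1 1 * τ 0 1 - C * τ 0 1 ^ 2) * q ^ 2) : ℤ)
        : ℝ) := by
      rw [Int.cast_neg, Int.cast_mul, ← hr, hC']
      push_cast
      ring
    rw [← dvd_neg, ← Int.cast_inj.mp this]
    exact hC
  have hwpos : (0 : ℤ) < width N q := by exact_mod_cast width_pos hN q
  have hrpos : 0 < r := by
    have : (0 : ℝ) < r := by rw [← hr]; positivity
    exact_mod_cast this
  have hwr : (width N q : ℤ) = r := by
    have hmr : (width N q : ℤ) = m * r := by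
      rw [hr] at hm
      exact_mod_cast hm
    exact Int.dvd_antisymm hwpos.le hrpos.le hrdvd ⟨m, by rw [hmr]; ring⟩
  have hwt : (width N q : ℝ) = t ^ 2 := by rw [hr, ← hwr]; rfl
  have hE : ((g 0 0 : ℝ) : ℂ) - (g 1 0 : ℝ) * (z : ℂ) = (t : ℂ) * ((p : ℂ) - q * z) := by
    rw [h00, h10]
    push_cast
    ring
  rw [im_SL_inv_smul, hE, Complex.normSq_mul, Complex.normSq_ofReal, cuspHeight, hwt, sq]

/-- Up to null sets and for large `Y`, the translates of the truncated fundamental domain fill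
the complement of the horoballs of height `Y`. -/
theorem truncPlane_ae_eq_thickPart {ι : Type*} {N : ℕ} (hN : N ≠ 0) {σ : ι → SL(2, ℝ)}
    (hσ : IsCuspSystem N σ) {D : Set ℍ} (hD : IsFundamentalDomainAt N σ D) :
    ∃ Y₀ : ℝ, ∀ Y, Y₀ < Y → truncPlane N σ D Y =ᵐ[volume] thickPart N Y := by
  have : NeZero N := ⟨hN⟩
  obtain ⟨Y₀, hY₀⟩ := hD.cusps
  have hmapGL : ∀ τ : SL(2, ℤ), Matrix.SpecialLinearGroup.mapGL ℝ τ =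
      Matrix.SpecialLinearGroup.mapGL ℝ
        (Matrix.SpecialLinearGroup.map (Int.castRingHom ℝ) τ) := by
    intro τ
    ext i j
    simp
  have hiff : ∀ c : OnePoint ℝ, IsCusp c ((CongruenceSubgroup.Gamma0 N).map
      (Matrix.SpecialLinearGroup.mapGL ℝ)) ↔
      ∃ τ : SL(2, ℤ), c = cuspOf (Matrix.SpecialLinearGroup.map (Int.castRingHom ℝ) τ) := by
    intro c
    rw [Subgroup.IsArithmetic.isCusp_iff_isCusp_SL2Z, isCusp_SL2Z_iff']
    simp only [cuspOf, hmapGL]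
  refine ⟨Y₀, fun Y hY => ?_⟩
  have hsub : truncPlane N σ D Y ⊆ thickPart N Y := by
    intro z hz
    simp only [truncPlane, Set.mem_iUnion, Set.mem_image] at hz
    obtain ⟨δ, hδ, x, ⟨hxD, hx⟩, rfl⟩ := hz
    refine smul_mem_thickPart hδ fun p q hpq => ?_
    obtain ⟨τ, h0, h1⟩ := hpq.exists_SL2_col 0
    obtain ⟨i, ⟨γ, hγ, hi⟩, -⟩ := hσ.complete _ ((hiff _).mpr ⟨τ, rfl⟩)
    obtain ⟨A, B, C, E, hdet, hC, hM⟩ := mem_Gam_iff.mp hγ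
    obtain ⟨κ, hκ⟩ : ∃ κ : SL(2, ℤ), (κ : Matrix (Fin 2) (Fin 2) ℤ) = !![A, B; C, E] :=
      ⟨⟨_, by rw [Matrix.det_fin_two_of]; exact hdet⟩, rfl⟩
    have hκγ : Matrix.SpecialLinearGroup.map (Int.castRingHom ℝ) κ = γ := by
      apply Subtype.ext
      rw [hM]
      ext i j
      fin_cases i <;> fin_cases j <;> simp [hκ]
    have hcusp : cuspOf (σ i) =
        cuspOf (Matrix.SpecialLinearGroup.map (Int.castRingHom ℝ) (κ * τ)) := by
      rw [map_mul, hκγ, ← smul_cuspOf, hi]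
    have him := im_inv_smul_eq_cuspHeight hN hcusp (hσ.stabilizer i) (γ • x)
    have e0 : (κ * τ) 0 0 = A * p + B * q := by
      simp [Matrix.mul_apply, Fin.sum_univ_two, hκ, h0, h1]
    have e1 : (κ * τ) 1 0 = C * p + E * q := by
      simp [Matrix.mul_apply, Fin.sum_univ_two, hκ, h0, h1]
    rw [e0, e1, cuspHeight_smul hdet hC hM] at him
    rw [← him]
    by_contra! hge
    -- high up in the cusp, `γ` fixes the cusp and preserves the height
    have hfix := hY₀ i γ hγ x hxD (hY.trans_le hge)
    obtain ⟨m, hm⟩ := (hσ.stabilizer i γ).mp ⟨hγ, hfix⟩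
    have heq : (σ i)⁻¹ • γ • x = ((σ i)⁻¹ * γ * σ i) • (σ i)⁻¹ • x := by
      rw [← mul_smul, ← mul_smul]
      congr 1
      group
    have hx' := hx i
    rw [heq, im_SL_smul] at hge
    rcases hm with hm | hm
    · simp [hm] at hge
      linarith
    · simp [hm] at hge
      linarith
  refine hsub.eventuallyLE.antisymm ?_
  filter_upwards [hD.covers] with z hz hzY
  obtain ⟨γ, hγ, hγz⟩ := hz
  change z ∈ truncPlane N σ D Y
  simp only [truncPlane, Set.mem_iUnion, Set.mem_image]
  refine ⟨γ⁻¹, inv_mem hγ, γ • z, ⟨hγz, fun i => ?_⟩, inv_smul_smul _ _⟩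
  obtain ⟨τ, hτ⟩ := (hiff _).mp (hσ.isCusp i)
  rw [im_inv_smul_eq_cuspHeight hN hτ (hσ.stabilizer i)]
  refine smul_mem_thickPart hγ hzY _ _ ⟨τ 1 1, -τ 0 1, ?_⟩
  have : τ 0 0 * τ 1 1 - τ 0 1 * τ 1 0 = 1 := by rw [← Matrix.det_fin_two]; exact τ.2
  linear_combination this

/-! ### The truncated integral of one hyperbolic element -/

theorem measurableSet_thickPart (N : ℕ) (Y : ℝ) : MeasurableSet (thickPart N Y) := by
  have h1 : Measurable fun z : ℍ => z.im := UpperHalfPlane.continuous_im.measurable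
  have : thickPart N Y = ⋂ p : ℤ, ⋂ q : ℤ, ⋂ _ : IsCoprime p q, {z | cuspHeight N p q z < Y} := by
    ext z
    simp [thickPart]
  rw [this]
  refine MeasurableSet.iInter fun p => MeasurableSet.iInter fun q => MeasurableSet.iInter fun _ =>
    measurableSet_lt ?_ measurable_const
  have h2 : Measurable fun z : ℍ => Complex.normSq ((p : ℂ) - (q : ℂ) * (z : ℂ)) :=
    (Complex.continuous_normSq.comp
      (continuous_const.sub (continuous_const.mul UpperHalfPlane.continuous_coe))).measurable
  exact h1.div (measurable_const.mul h2)

/-- The kernel of a dilation. -/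
theorem kernel_dilation {s : ℂ} {a d n : ℕ} (ha : 0 < a) (hd : 0 < d) (had : a * d = n)
    {z w : ℍ} (hw : (w : ℂ) = ((a : ℝ) / d : ℝ) * (z : ℂ)) :
    kernel s z w = profile s (((a : ℝ) - d) ^ 2 / n) (z.re / z.im) := by
  have ha' : (0 : ℝ) < a := by exact_mod_cast ha
  have hd' : (0 : ℝ) < d := by exact_mod_cast hd
  have hz := z.im_pos
  have him : w.im = (a : ℝ) / d * z.im := by
    have := congrArg Complex.im hw
    rwa [Complex.im_ofReal_mul] at this
  have hsub : (z : ℂ) - w = ((1 - (a : ℝ) / d : ℝ) : ℂ) * z := by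
    rw [hw]
    push_cast
    ring
  have hn : ‖(z : ℂ)‖ ^ 2 = z.re ^ 2 + z.im ^ 2 := by
    rw [← Complex.normSq_eq_norm_sq, Complex.normSq_apply]
    change z.re * z.re + z.im * z.im = _
    ring
  rw [kernel, profile, hsub, norm_mul, mul_pow, hn, Complex.norm_real, Real.norm_eq_abs, sq_abs,
    him, ← had]
  congr 1
  push_cast
  field_simp
  ring

theorem cuspHeight_smul_of_cols {N : ℕ} {p₁ q₁ p₂ q₂ : ℤ} {G : SL(2, ℝ)} {δ : ℝ}
    (hG : (G : Matrix (Fin 2) (Fin 2) ℝ) = !![(p₁ : ℝ), p₂ * δ; (q₁ : ℝ), q₂ * δ])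
    (p q : ℤ) (z : ℍ) :
    cuspHeight N p q (G • z) = z.im / (width N q * Complex.normSq
      (((p * q₁ - q * p₁ : ℤ) : ℂ) * z + (((p * q₂ - q * p₂ : ℤ) * δ : ℝ) : ℂ))) := by
  have hden := SL_denom_ne_zero G z
  have hc := coe_SL_smul G z
  have him := im_SL_smul G z
  simp only [hG, Matrix.of_apply, Matrix.cons_val', Matrix.cons_val_zero, Matrix.cons_val_one,
    Matrix.cons_val_fin_one] at hden hc him
  have hE : (p : ℂ) - q * ((G • z : ℍ) : ℂ) =
      (((p * q₁ - q * p₁ : ℤ) : ℂ) * z + (((p * q₂ - q * p₂ : ℤ) * δ : ℝ) : ℂ)) /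
        (((q₁ : ℝ) : ℂ) * z + ((q₂ * δ : ℝ) : ℂ)) := by
    rw [hc, eq_div_iff hden, sub_mul, mul_assoc, div_mul_cancel₀ _ hden]
    push_cast
    ring
  have hn := (Complex.normSq_pos.mpr hden).ne'
  rw [cuspHeight, hE, him, Complex.normSq_div]
  field_simp

/-- In the coordinate in which the fixed points `p₁/q₁`, `p₂/q₂` are `∞` and `0`, the complement of
the horoballs lies between the horocycles at these two points, and the horoballs at all
other cusps lie close to the real axis. -/
theorem thickPart_between_horocycles {N : ℕ} (hN : N ≠ 0) {p₁ q₁ p₂ q₂ : ℤ}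
    (h₁ : IsCoprime p₁ q₁) (h₂ : IsCoprime p₂ q₂) {Δ : ℤ} (hΔ : Δ = p₁ * q₂ - p₂ * q₁)
    (hΔ0 : Δ ≠ 0) {G : SL(2, ℝ)}
    (hG : (G : Matrix (Fin 2) (Fin 2) ℝ) =
      !![(p₁ : ℝ), p₂ * (Δ : ℝ)⁻¹; (q₁ : ℝ), q₂ * (Δ : ℝ)⁻¹]) {Y : ℝ} (hY : 0 < Y) :
    (fun z : ℍ => G • z) ⁻¹' thickPart N Y ⊆
      horoBox (width N q₁ * Y) (width N q₂ * Δ ^ 2 * Y) ∧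
    horoBox (width N q₁ * Y) (width N q₂ * Δ ^ 2 * Y) \ (fun z : ℍ => G • z) ⁻¹' thickPart N Y ⊆
      horoBox (2 / Y) (2 * Δ ^ 2 / Y) := by
  have hΔR : (Δ : ℝ) ≠ 0 := by exact_mod_cast hΔ0
  have hwpos : ∀ q : ℤ, (1 : ℝ) ≤ width N q := fun q => by exact_mod_cast width_pos hN q
  have hH := fun p q z => cuspHeight_smul_of_cols (N := N) hG p q z
  have hz0 : ∀ z : ℍ, 0 < Complex.normSq (z : ℂ) := fun z =>
    Complex.normSq_pos.mpr (UpperHalfPlane.ne_zero z)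
  constructor
  · intro z hz
    have hw1 := hwpos q₁
    have hw2 := hwpos q₂
    have := hz0 z
    constructor
    · have h := hz p₁ q₁ h₁
      have e1 : p₁ * q₁ - q₁ * p₁ = 0 := by ring
      have e2 : p₁ * q₂ - q₁ * p₂ = Δ := by rw [hΔ]; ring
      rw [hH, e1, e2, mul_inv_cancel₀ hΔR] at h
      simp only [Int.cast_zero, zero_mul, zero_add, Complex.ofReal_one, Complex.normSq_one,
        mul_one] at h
      rw [div_lt_iff₀ (by positivity)] at h
      linarith
    · have h := hz p₂ q₂ h₂
      have e1 : p₂ * q₁ - q₂ * p₁ = -Δ := by rw [hΔ]; ring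
      have e2 : p₂ * q₂ - q₂ * p₂ = 0 := by ring
      rw [hH, e1, e2] at h
      have e3 : Complex.normSq (((-Δ : ℤ) : ℂ) * z + (((0 : ℤ) * (Δ : ℝ)⁻¹ : ℝ) : ℂ)) =
          Δ ^ 2 * Complex.normSq (z : ℂ) := by
        rw [Int.cast_zero, zero_mul, Complex.ofReal_zero, add_zero, Complex.normSq_mul,
          ← Complex.ofReal_intCast, Complex.normSq_ofReal]
        push_cast
        ring
      rw [e3, div_lt_iff₀ (by positivity)] at h
      rw [div_lt_iff₀ this]
      linarith
  · rintro z ⟨⟨hb1, hb2⟩, hz⟩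
    have hzn := hz0 z
    have hy := z.im_pos
    rw [div_lt_iff₀ hzn] at hb2
    have hz' : ¬ ∀ p q : ℤ, IsCoprime p q → cuspHeight N p q (G • z) < Y := hz
    push Not at hz'
    obtain ⟨p, q, hpq, hge⟩ := hz'
    rw [hH] at hge
    set m₁ : ℤ := p * q₁ - q * p₁ with hm₁
    set m₂ : ℤ := p * q₂ - q * p₂ with hm₂
    set W : ℂ := (m₁ : ℂ) * z + ((m₂ * (Δ : ℝ)⁻¹ : ℝ) : ℂ) with hW
    have hsign : ∀ {p' q' : ℤ}, IsCoprime p' q' → p * q' - q * p' = 0 →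
        (p = p' ∧ q = q') ∨ (p = -p' ∧ q = -q') := by
      intro p' q' hc h0
      have hpp : p ∣ p' := hpq.dvd_of_dvd_mul_left (by exact ⟨q', by linarith⟩)
      have hqq : q ∣ q' := hpq.symm.dvd_of_dvd_mul_left (by exact ⟨p', by linarith⟩)
      have hpp' : p' ∣ p := hc.dvd_of_dvd_mul_right (by exact ⟨q, by linarith⟩)
      obtain ⟨u, v, huv⟩ := hpq
      -- `(p', q') = e (p, q)` with `e = u p' + v q'` a unit
      have k1 : p' = (u * p' + v * q') * p := by linear_combination -p' * huv - v * h0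
      have k2 : q' = (u * p' + v * q') * q := by linear_combination -q' * huv + u * h0
      have hunit : IsUnit (u * p' + v * q') := by
        obtain ⟨u', v', huv'⟩ := hc
        refine IsUnit.of_mul_eq_one (u' * p + v' * q) ?_
        linear_combination huv' - u' * k1 - v' * k2
      rcases Int.isUnit_iff.mp hunit with he | he
      · rw [he] at k1 k2
        left; constructor <;> linarith
      · rw [he] at k1 k2
        right; constructor <;> linarith
    have hwneg : ∀ q' : ℤ, width N (-q') = width N q' := fun q' => by simp [width]
    have hne1 : m₁ ≠ 0 := by
      intro h0
      have hq : width N q = width N q₁ ∧ m₂ ^ 2 = Δ ^ 2 := by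
        rcases hsign h₁ h0 with ⟨rfl, rfl⟩ | ⟨rfl, rfl⟩
        · exact ⟨rfl, by rw [hm₂, hΔ]; ring⟩
        · exact ⟨hwneg _, by rw [hm₂, hΔ]; ring⟩
      have hq2 : (m₂ : ℝ) ^ 2 = Δ ^ 2 := by exact_mod_cast hq.2
      have hWn : Complex.normSq W = 1 := by
        rw [hW, h0, Int.cast_zero, zero_mul, zero_add, Complex.normSq_ofReal, ← sq, mul_pow, hq2,
          ← mul_pow, mul_inv_cancel₀ hΔR, one_pow]
      have hw1 := hwpos q₁
      rw [hWn, hq.1, mul_one, le_div_iff₀ (by positivity)] at hge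
      linarith
    have hne2 : m₂ ≠ 0 := by
      intro h0
      have hq : width N q = width N q₂ ∧ m₁ ^ 2 = Δ ^ 2 := by
        rcases hsign h₂ h0 with ⟨rfl, rfl⟩ | ⟨rfl, rfl⟩
        · exact ⟨rfl, by rw [hm₁, hΔ]; ring⟩
        · exact ⟨hwneg _, by rw [hm₁, hΔ]; ring⟩
      have hq2 : (m₁ : ℝ) ^ 2 = Δ ^ 2 := by exact_mod_cast hq.2
      have hWn : Complex.normSq W = Δ ^ 2 * Complex.normSq (z : ℂ) := by
        rw [hW, h0, Int.cast_zero, zero_mul, Complex.ofReal_zero, add_zero, Complex.normSq_mul,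
          ← Complex.ofReal_intCast, Complex.normSq_ofReal, ← sq, hq2]
      have hw2 := hwpos q₂
      rw [hWn, hq.1, le_div_iff₀ (by positivity)] at hge
      linarith
    have hm1 : (1 : ℝ) ≤ (m₁ : ℝ) ^ 2 := by
      have : 0 < m₁ ^ 2 := by positivity
      exact_mod_cast Int.add_one_le_of_lt this
    have hm2 : (1 : ℝ) ≤ (m₂ : ℝ) ^ 2 := by
      have : 0 < m₂ ^ 2 := by positivity
      exact_mod_cast Int.add_one_le_of_lt this
    have hre : W.re = m₁ * z.re + m₂ * (Δ : ℝ)⁻¹ := by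
      rw [hW, ← Complex.ofReal_intCast, Complex.add_re, Complex.re_ofReal_mul, Complex.ofReal_re]
      rfl
    have him : W.im = m₁ * z.im := by
      rw [hW, ← Complex.ofReal_intCast, Complex.add_im, Complex.im_ofReal_mul, Complex.ofReal_im,
        add_zero]
      rfl
    have hWpos : 0 < Complex.normSq W := by
      rw [Complex.normSq_apply, him]
      have : 0 < (m₁ * z.im) * (m₁ * z.im) := by
        have : m₁ * z.im * (m₁ * z.im) = (m₁ : ℝ) ^ 2 * z.im ^ 2 := by ring
        rw [this]; positivity
      nlinarith [mul_self_nonneg W.re]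
    have hw := hwpos q
    rw [le_div_iff₀ (by positivity)] at hge
    have hge' : Y * Complex.normSq W ≤ z.im := by
      refine le_trans ?_ hge
      refine mul_le_mul_of_nonneg_left ?_ hY.le
      nlinarith
    -- the two lower bounds for `|W|²`, from the imaginary parts of `W` and of `W * conj z`
    have hlow1 : z.im ^ 2 ≤ Complex.normSq W := by
      rw [Complex.normSq_apply, him]
      nlinarith [mul_self_nonneg W.re, sq_nonneg z.im]
    have hlow2 : z.im ^ 2 * (Δ : ℝ)⁻¹ ^ 2 ≤ Complex.normSq W * Complex.normSq (z : ℂ) := by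
      have hid : Complex.normSq W * Complex.normSq (z : ℂ) =
          (W.re * z.re + W.im * z.im) ^ 2 + (W.im * z.re - W.re * z.im) ^ 2 := by
        rw [Complex.normSq_apply, Complex.normSq_apply]
        change _ * (z.re * z.re + z.im * z.im) = _
        ring
      have hid2 : W.im * z.re - W.re * z.im = -(m₂ * (Δ : ℝ)⁻¹ * z.im) := by
        rw [hre, him]; ring
      rw [hid, hid2]
      have : 0 ≤ z.im ^ 2 * (Δ : ℝ)⁻¹ ^ 2 := by positivity
      nlinarith [sq_nonneg (W.re * z.re + W.im * z.im)]
    constructor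
    · rw [lt_div_iff₀ hY]
      have : Y * z.im ^ 2 ≤ z.im := (mul_le_mul_of_nonneg_left hlow1 hY.le).trans hge'
      have : Y * z.im ≤ 1 := by
        by_contra! h
        nlinarith
      linarith
    · rw [div_lt_div_iff₀ hzn hY]
      have h3 : Y * (z.im ^ 2 * (Δ : ℝ)⁻¹ ^ 2) ≤ z.im * Complex.normSq (z : ℂ) := by
        calc _ ≤ Y * (Complex.normSq W * Complex.normSq (z : ℂ)) :=
              mul_le_mul_of_nonneg_left hlow2 hY.le
          _ = Y * Complex.normSq W * Complex.normSq (z : ℂ) := by ring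
          _ ≤ _ := mul_le_mul_of_nonneg_right hge' hzn.le
      have h4 : Y * z.im * (Δ : ℝ)⁻¹ ^ 2 ≤ Complex.normSq (z : ℂ) := by
        refine le_of_mul_le_mul_left ?_ hy
        linarith
      have h5 : Y * z.im ≤ Δ ^ 2 * Complex.normSq (z : ℂ) := by
        calc Y * z.im = Δ ^ 2 * (Y * z.im * (Δ : ℝ)⁻¹ ^ 2) := by field_simp
          _ ≤ _ := mul_le_mul_of_nonneg_left h4 (by positivity)
      have h6 : 0 < (Δ : ℝ) ^ 2 * Complex.normSq (z : ℂ) := by positivity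
      linarith

/-- The integral of `k(z, Pz)` over the complement of the horoballs of height `Y`, for a
hyperbolic `P` fixing two cusps. -/
theorem tendsto_integral_thickPart {s : ℂ} (hs : 1 < s.re) {N : ℕ} (hN : N ≠ 0) {n a d : ℕ}
    (ha : 0 < a) (hd : 0 < d) (hne : a ≠ d) (had : a * d = n) {p₁ q₁ p₂ q₂ : ℤ}
    (h₁ : IsCoprime p₁ q₁) (h₂ : IsCoprime p₂ q₂) {Δ : ℤ} (hΔ : Δ = p₁ * q₂ - p₂ * q₁)
    (hΔ0 : Δ ≠ 0) {P : SL(2, ℝ)}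
    (hP₁ : (P : Matrix (Fin 2) (Fin 2) ℝ).mulVec ![(p₁ : ℝ), q₁] = ((a : ℝ) / √n) • ![(p₁ : ℝ), q₁])
    (hP₂ : (P : Matrix (Fin 2) (Fin 2) ℝ).mulVec ![(p₂ : ℝ), q₂] =
      ((d : ℝ) / √n) • ![(p₂ : ℝ), q₂]) :
    (∀ Y, 0 < Y → IntegrableOn (fun z : ℍ => kernel s z (P • z)) (thickPart N Y)) ∧
    Filter.Tendsto (fun Y : ℝ => (∫ z in thickPart N Y, kernel s z (P • z)) -
      (((2 * Real.log Y + Real.log (width N q₁ * (width N q₂ * Δ ^ 2)) : ℝ) : ℂ) *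
        (((√(n : ℝ) : ℝ) : ℂ) * gfun s (Real.log ((a : ℝ) / d)) / ((|(a : ℝ) - d| : ℝ) : ℂ)) +
        ∫ t in Set.Ioi (1 : ℝ), tailIntegrand s n a d t)) Filter.atTop (nhds 0) := by
  have ha' : (0 : ℝ) < a := by exact_mod_cast ha
  have hd' : (0 : ℝ) < d := by exact_mod_cast hd
  have hn0 : 0 < n := by rw [← had]; positivity
  have hn' : (0 : ℝ) < n := by exact_mod_cast hn0
  have hsub : (a : ℝ) - d ≠ 0 := sub_ne_zero.mpr (by exact_mod_cast hne)
  have hκ : 0 < ((a : ℝ) - d) ^ 2 / n := by positivity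
  have hΔR : (Δ : ℝ) ≠ 0 := by exact_mod_cast hΔ0
  have hΔ' : (Δ : ℝ) = p₁ * q₂ - p₂ * q₁ := by exact_mod_cast hΔ
  have hsn : 0 < √(n : ℝ) := Real.sqrt_pos.mpr hn'
  have hnsq : √(n : ℝ) * √(n : ℝ) = a * d := by
    rw [Real.mul_self_sqrt hn'.le, ← had]; push_cast; rfl
  obtain ⟨G, hG⟩ : ∃ G : SL(2, ℝ), (G : Matrix (Fin 2) (Fin 2) ℝ) =
      !![(p₁ : ℝ), p₂ * (Δ : ℝ)⁻¹; (q₁ : ℝ), q₂ * (Δ : ℝ)⁻¹] := by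
    refine ⟨⟨_, ?_⟩, rfl⟩
    rw [Matrix.det_fin_two_of]
    field_simp
    rw [hΔ']
  obtain ⟨E, hE⟩ : ∃ E : SL(2, ℝ), (E : Matrix (Fin 2) (Fin 2) ℝ) =
      !![(a : ℝ) / √n, 0; 0, (d : ℝ) / √n] := by
    refine ⟨⟨_, ?_⟩, rfl⟩
    rw [Matrix.det_fin_two_of, div_mul_div_comm, hnsq]
    field_simp
    ring
  have hPG : P * G = G * E := by
    apply Subtype.ext
    rw [Matrix.SpecialLinearGroup.coe_mul, Matrix.SpecialLinearGroup.coe_mul, hG, hE]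
    have e10 := congrFun hP₁ 0
    have e11 := congrFun hP₁ 1
    have e20 := congrFun hP₂ 0
    have e21 := congrFun hP₂ 1
    simp [Matrix.mulVec, dotProduct, Fin.sum_univ_two] at e10 e11 e20 e21
    ext i j
    fin_cases i <;> fin_cases j <;> simp [Matrix.mul_apply, Fin.sum_univ_two]
    · linear_combination e10
    · linear_combination (Δ : ℝ)⁻¹ * e20
    · linear_combination e11
    · linear_combination (Δ : ℝ)⁻¹ * e21
  have hker : ∀ z : ℍ, kernel s (G • z) (P • G • z) =
      profile s (((a : ℝ) - d) ^ 2 / n) (z.re / z.im) := by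
    intro z
    rw [← mul_smul, hPG, mul_smul, kernel_smul]
    refine kernel_dilation ha hd had ?_
    rw [coe_SL_smul, hE]
    have : ((√(n : ℝ) : ℝ) : ℂ) ≠ 0 := by exact_mod_cast hsn.ne'
    have : (d : ℂ) ≠ 0 := by exact_mod_cast hd.ne'
    simp
    field_simp
  have hmp : MeasurePreserving (fun z : ℍ => G • z) volume volume :=
    measurePreserving_smul (Matrix.SpecialLinearGroup.mapGL ℝ G) (volume : Measure ℍ)
  have hemb : MeasurableEmbedding (fun z : ℍ => G • z) :=
    (MeasurableEquiv.smul (α := ℍ) (Matrix.SpecialLinearGroup.mapGL ℝ G)).measurableEmbedding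
  have hwpos : ∀ q : ℤ, (0 : ℝ) < width N q := fun q => by exact_mod_cast width_pos hN q
  have hw1 := hwpos q₁
  have hw2 := hwpos q₂
  have key := tendsto_integral_between_horocycles hs hκ (a₁ := width N q₁)
    (a₂ := width N q₂ * Δ ^ 2) (c₁ := 2) (c₂ := 2 * Δ ^ 2) (by positivity) (by positivity)
    (by positivity) (by positivity) (S := fun Y => (fun z : ℍ => G • z) ⁻¹' thickPart N Y)
    (fun Y _ => hmp.measurable (measurableSet_thickPart N Y))
    (fun Y hY => (thickPart_between_horocycles hN h₁ h₂ hΔ hΔ0 hG hY).1)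
    (fun Y hY => (thickPart_between_horocycles hN h₁ h₂ hΔ hΔ0 hG hY).2)
  simp only [← hker] at key
  rw [integral_profile_eq_gfun hs ha hd hne had, (integral_log_profile hs hn0 hne).2] at key
  refine ⟨fun Y hY => ?_, ?_⟩
  · rw [← hmp.integrableOn_comp_preimage hemb]
    exact key.1 Y hY
  · refine key.2.congr fun Y => ?_
    congr 1
    exact hmp.setIntegral_preimage_emb hemb (fun z => kernel s z (P • z)) _

/-! ### Integral matrices -/

/-- `P` is `n^(-1/2) M` for the integral matrix `M`. -/
def IsScaled (n : ℕ) (M : Matrix (Fin 2) (Fin 2) ℤ) (P : SL(2, ℝ)) : Prop :=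
  (P : Matrix (Fin 2) (Fin 2) ℝ) = (1 / √(n : ℝ)) • M.map (Int.cast : ℤ → ℝ)

theorem exists_isScaled {n : ℕ} (hn : 0 < n) {M : Matrix (Fin 2) (Fin 2) ℤ} (hM : M.det = n) :
    ∃ P : SL(2, ℝ), IsScaled n M P := by
  have hn' : (0 : ℝ) < n := by exact_mod_cast hn
  refine ⟨⟨(1 / √(n : ℝ)) • M.map (Int.cast : ℤ → ℝ), ?_⟩, rfl⟩
  rw [Matrix.det_fin_two] at hM
  have hM' : (M 0 0 : ℝ) * M 1 1 - M 0 1 * M 1 0 = n := by exact_mod_cast hM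
  have hsq := Real.mul_self_sqrt hn'.le
  have hsn : √(n : ℝ) ≠ 0 := (Real.sqrt_pos.mpr hn').ne'
  rw [Matrix.det_fin_two]
  simp only [Matrix.smul_apply, Matrix.map_apply, smul_eq_mul]
  field_simp
  rw [hM', sq, hsq]

theorem IsScaled.neg {n : ℕ} {M : Matrix (Fin 2) (Fin 2) ℤ} {P : SL(2, ℝ)} (h : IsScaled n M P) :
    IsScaled n (-M) (-P) := by
  have : (-M).map (Int.cast : ℤ → ℝ) = -M.map (Int.cast : ℤ → ℝ) := by ext i j; simp
  rw [IsScaled, this, Matrix.SpecialLinearGroup.coe_neg, h, smul_neg]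

theorem IsScaled.mul_eq_iff {n : ℕ} (hn : 0 < n) {M M' : Matrix (Fin 2) (Fin 2) ℤ} {P P' : SL(2, ℝ)}
    (h : IsScaled n M P) (h' : IsScaled n M' P') (g : SL(2, ℤ)) :
    (P' * Matrix.SpecialLinearGroup.map (Int.castRingHom ℝ) g =
        Matrix.SpecialLinearGroup.map (Int.castRingHom ℝ) g * P ↔ M' * g = g * M) ∧
    (P' * Matrix.SpecialLinearGroup.map (Int.castRingHom ℝ) g =
        -(Matrix.SpecialLinearGroup.map (Int.castRingHom ℝ) g * P) ↔ M' * g = -(g * M)) := by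
  have hn' : (0 : ℝ) < n := by exact_mod_cast hn
  have hs : (1 / √(n : ℝ)) ≠ 0 := by positivity
  have hcoe : ((Matrix.SpecialLinearGroup.map (Int.castRingHom ℝ) g : SL(2, ℝ)) :
      Matrix (Fin 2) (Fin 2) ℝ) = (g : Matrix (Fin 2) (Fin 2) ℤ).map (Int.castRingHom ℝ) := rfl
  have hinj : Function.Injective
      fun A : Matrix (Fin 2) (Fin 2) ℤ => A.map (Int.castRingHom ℝ) :=
    Matrix.map_injective Int.cast_injective
  have hM : ∀ {M : Matrix (Fin 2) (Fin 2) ℤ} {P : SL(2, ℝ)}, IsScaled n M P →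
      (P : Matrix (Fin 2) (Fin 2) ℝ) = (1 / √(n : ℝ)) • M.map (Int.castRingHom ℝ) := fun h => h
  have hneg : ∀ A : Matrix (Fin 2) (Fin 2) ℤ,
      (-A).map (Int.castRingHom ℝ) = -A.map (Int.castRingHom ℝ) := by
    intro A; ext i j; simp
  have hce : ∀ A B : SL(2, ℝ), A = B ↔
      (A : Matrix (Fin 2) (Fin 2) ℝ) = (B : Matrix (Fin 2) (Fin 2) ℝ) :=
    fun A B => ⟨congrArg _, fun h => Subtype.ext h⟩
  constructor
  · rw [hce, Matrix.SpecialLinearGroup.coe_mul, Matrix.SpecialLinearGroup.coe_mul,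
      hM h, hM h', hcoe, Matrix.smul_mul, Matrix.mul_smul, smul_right_inj hs, ← Matrix.map_mul,
      ← Matrix.map_mul]
    exact hinj.eq_iff
  · rw [hce, Matrix.SpecialLinearGroup.coe_neg, Matrix.SpecialLinearGroup.coe_mul,
      Matrix.SpecialLinearGroup.coe_mul, hM h, hM h', hcoe, Matrix.smul_mul, Matrix.mul_smul,
      ← smul_neg, smul_right_inj hs, ← Matrix.map_mul, ← Matrix.map_mul, ← hneg]
    exact hinj.eq_iff

theorem mem_Gam_iff_exists {N : ℕ} {γ : SL(2, ℝ)} :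
    γ ∈ Gam N ↔ ∃ g : SL(2, ℤ), (N : ℤ) ∣ g 1 0 ∧
      Matrix.SpecialLinearGroup.map (Int.castRingHom ℝ) g = γ := by
  rw [Gam, Subgroup.mem_map]
  simp only [CongruenceSubgroup.Gamma0_mem, ZMod.intCast_zmod_eq_zero_iff_dvd]

theorem conj_iff {N n : ℕ} (hn : 0 < n) {M M' : Matrix (Fin 2) (Fin 2) ℤ} {P P' : SL(2, ℝ)}
    (h : IsScaled n M P) (h' : IsScaled n M' P') :
    Conj N P P' ↔ ∃ g : SL(2, ℤ), (N : ℤ) ∣ g 1 0 ∧ (M' * g = g * M ∨ M' * g = -(g * M)) := by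
  constructor
  · rintro ⟨γ, hγ, hc⟩
    obtain ⟨g, hg, rfl⟩ := mem_Gam_iff_exists.mp hγ
    refine ⟨g, hg, ?_⟩
    rw [← (h.mul_eq_iff hn h' g).1, ← (h.mul_eq_iff hn h' g).2]
    refine hc.imp (fun e => ?_) fun e => ?_
    · rw [e, inv_mul_cancel_right]
    · rw [e, neg_mul, inv_mul_cancel_right]
  · rintro ⟨g, hg, hc⟩
    rw [← (h.mul_eq_iff hn h' g).1, ← (h.mul_eq_iff hn h' g).2] at hc
    refine ⟨_, mem_Gam_iff_exists.mpr ⟨g, hg, rfl⟩, ?_⟩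
    refine hc.imp (fun e => ?_) fun e => ?_
    · rw [← e, mul_inv_cancel_right]
    · rw [← neg_mul, ← e, mul_inv_cancel_right]

/-- `Γ*` consists of the scaled integral matrices of determinant `n` whose lower left entry is
divisible by `N`. -/
theorem mem_GamStar_iff {N n : ℕ} (hn : 0 < n) (hnN : Nat.Coprime n N) {T : SL(2, ℝ)} :
    T ∈ GamStar N n ↔ ∃ M : Matrix (Fin 2) (Fin 2) ℤ, M.det = n ∧ (N : ℤ) ∣ M 1 0 ∧
      IsScaled n M T := by
  constructor
  · rintro ⟨a, d, b, had, -, γ, hγ, hT⟩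
    obtain ⟨g, hg, rfl⟩ := mem_Gam_iff_exists.mp hγ
    refine ⟨!![(d : ℤ), -(b : ℤ); 0, (a : ℤ)] * g, ?_, ?_, ?_⟩
    · rw [Matrix.det_mul, g.2, Matrix.det_fin_two_of, ← had]
      push_cast
      ring
    · simp only [Matrix.mul_apply, Fin.sum_univ_two]
      simpa using hg.mul_left (a : ℤ)
    · rw [IsScaled, hT]
      congr 1
      ext i j
      fin_cases i <;> fin_cases j <;> simp [Matrix.vecMul, dotProduct, Fin.sum_univ_two]
  · rintro ⟨M, hdet, hN, hT⟩
    rw [Matrix.det_fin_two] at hdet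
    have hn' : (n : ℤ) ≠ 0 := by exact_mod_cast hn.ne'
    -- the Hermite form of `M`: `a` is the greatest common divisor of the lower row
    set a : ℕ := Int.gcd (M 1 0) (M 1 1) with ha
    obtain ⟨γ', hγ'⟩ := Int.gcd_dvd_left (M 1 0) (M 1 1)
    obtain ⟨δ', hδ'⟩ := Int.gcd_dvd_right (M 1 0) (M 1 1)
    rw [← ha] at hγ' hδ'
    have hadvd : (a : ℤ) ∣ n := ⟨M 0 0 * δ' - M 0 1 * γ', by
      linear_combination -hdet + M 0 0 * hδ' - M 0 1 * hγ'⟩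
    obtain ⟨d, hd⟩ := Int.natCast_dvd_natCast.mp hadvd
    have hd' : (n : ℤ) = a * d := by exact_mod_cast hd
    have ha0 : (a : ℤ) ≠ 0 := by rintro h; rw [h, zero_mul] at hd'; exact hn' hd'
    have hd0 : (0 : ℤ) < d := by
      refine lt_of_le_of_ne (by positivity) fun h => ?_
      rw [← h, mul_zero] at hd'; exact hn' hd'
    have hdd : M 0 0 * δ' - M 0 1 * γ' = d := by
      apply mul_left_cancel₀ ha0
      linear_combination hdet + hd' - M 0 0 * hδ' + M 0 1 * hγ'
    obtain ⟨u, v, huv⟩ : ∃ u v : ℤ, γ' * u + δ' * v = 1 := by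
      refine ⟨Int.gcdA (M 1 0) (M 1 1), Int.gcdB (M 1 0) (M 1 1), mul_left_cancel₀ ha0 ?_⟩
      have := Int.gcd_eq_gcd_ab (M 1 0) (M 1 1)
      rw [← ha] at this
      linear_combination -this - Int.gcdA (M 1 0) (M 1 1) * hγ' - Int.gcdB (M 1 0) (M 1 1) * hδ'
    set b₀ : ℤ := -(u * M 0 0 + v * M 0 1) with hb₀
    set k : ℤ := b₀ / d with hk
    have hb1 : 0 ≤ b₀ % d := Int.emod_nonneg _ hd0.ne'
    have hb2 : b₀ % d < d := Int.emod_lt_of_pos _ hd0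
    have hbk : b₀ % d = b₀ - d * k := by rw [hk, Int.emod_def]
    obtain ⟨b, hb⟩ := Int.eq_ofNat_of_zero_le hb1
    -- the quotient matrix
    obtain ⟨g, hg⟩ : ∃ g : SL(2, ℤ), (g : Matrix (Fin 2) (Fin 2) ℤ) =
        !![v - k * γ', -u - k * δ'; γ', δ'] := by
      refine ⟨⟨_, ?_⟩, rfl⟩
      rw [Matrix.det_fin_two_of]
      linear_combination huv
    have hMg : M = !![(d : ℤ), -(b : ℤ); 0, (a : ℤ)] * g := by
      have hbb : (b : ℤ) = b₀ - d * k := by rw [← hbk, hb]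
      rw [hg, hbb, hb₀]
      ext i j
      fin_cases i <;> fin_cases j <;> simp [Matrix.mul_apply, Fin.sum_univ_two]
      · linear_combination v * hdd - M 0 0 * huv
      · linear_combination -u * hdd - M 0 1 * huv
      · exact hγ'
      · exact hδ'
    refine ⟨a, d, b, hd.symm, by rw [hb] at hb2; exact_mod_cast hb2, _,
      mem_Gam_iff_exists.mpr ⟨g, ?_, rfl⟩, ?_⟩
    · have hcop : IsCoprime (N : ℤ) (a : ℤ) := by
        have : IsCoprime (n : ℤ) (N : ℤ) := Nat.isCoprime_iff_coprime.mpr hnN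
        exact (this.of_isCoprime_of_dvd_left hadvd).symm
      rw [hg]
      change (N : ℤ) ∣ γ'
      rw [hγ'] at hN
      exact hcop.dvd_of_dvd_mul_left hN
    · rw [hT]
      congr 1
      nth_rw 1 [hMg]
      ext i j
      fin_cases i <;> fin_cases j <;> simp [Matrix.vecMul, dotProduct, Fin.sum_univ_two]

/-! ### Hyperbolic elements with trivial centralizer -/

theorem trivialCentralizer_iff {N n : ℕ} (hn : 0 < n) {M : Matrix (Fin 2) (Fin 2) ℤ} {P : SL(2, ℝ)}
    (h : IsScaled n M P) :
    TrivialCentralizer N P ↔ ∀ g : SL(2, ℤ), (N : ℤ) ∣ g 1 0 →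
      (M * g = g * M ∨ M * g = -(g * M)) → g = 1 ∨ g = -1 := by
  have hinj : Function.Injective
      (Matrix.SpecialLinearGroup.map (Int.castRingHom ℝ) : SL(2, ℤ) → SL(2, ℝ)) := by
    intro g g' hgg
    apply Subtype.ext
    ext i j
    have := congrArg (fun A : SL(2, ℝ) => (A : Matrix (Fin 2) (Fin 2) ℝ) i j) hgg
    simpa using this
  have hneg : ∀ g : SL(2, ℤ), Matrix.SpecialLinearGroup.map (Int.castRingHom ℝ) (-g) =
      -Matrix.SpecialLinearGroup.map (Int.castRingHom ℝ) g := by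
    intro g
    apply Subtype.ext
    ext i j
    simp
  have hone : ∀ g : SL(2, ℤ), (Matrix.SpecialLinearGroup.map (Int.castRingHom ℝ) g = 1 ∨
      Matrix.SpecialLinearGroup.map (Int.castRingHom ℝ) g = -1) ↔ (g = 1 ∨ g = -1) := by
    intro g
    rw [← hinj.eq_iff (a := g) (b := 1), ← hinj.eq_iff (a := g) (b := -1), hneg, map_one]
  have hflip : ∀ γ : SL(2, ℝ), (γ * P = P * γ ∨ γ * P = -(P * γ)) ↔
      (P * γ = γ * P ∨ P * γ = -(γ * P)) := by
    intro γ
    refine or_congr eq_comm ⟨fun e => ?_, fun e => ?_⟩ <;> rw [e, neg_neg]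
  constructor
  · intro H g hg hc
    rw [← hone]
    refine H _ (mem_Gam_iff_exists.mpr ⟨g, hg, rfl⟩) ?_
    rw [hflip, (h.mul_eq_iff hn h g).1, (h.mul_eq_iff hn h g).2]
    exact hc
  · intro H γ hγ hc
    obtain ⟨g, hg, rfl⟩ := mem_Gam_iff_exists.mp hγ
    rw [hone]
    refine H g hg ?_
    rwa [hflip, (h.mul_eq_iff hn h g).1, (h.mul_eq_iff hn h g).2] at hc

theorem isHyperbolic_iff {n : ℕ} (hn : 0 < n) {M : Matrix (Fin 2) (Fin 2) ℤ} {P : SL(2, ℝ)}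
    (h : IsScaled n M P) :
    (P : Matrix (Fin 2) (Fin 2) ℝ).IsHyperbolic ↔ 0 < M.trace ^ 2 - 4 * M.det := by
  have hn' : (0 : ℝ) < n := by exact_mod_cast hn
  have hs : 0 < (1 / √(n : ℝ)) := by positivity
  have hd : (P : Matrix (Fin 2) (Fin 2) ℝ).discr =
      (1 / √(n : ℝ)) ^ 2 * ((M.trace ^ 2 - 4 * M.det : ℤ) : ℝ) := by
    rw [Matrix.discr_fin_two, h, Matrix.trace_fin_two, Matrix.det_fin_two, Matrix.trace_fin_two,
      Matrix.det_fin_two]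
    simp only [Matrix.smul_apply, Matrix.map_apply, smul_eq_mul]
    push_cast
    ring
  rw [Matrix.IsHyperbolic, hd, mul_pos_iff_of_pos_left (by positivity), Int.cast_pos]

/-- If the discriminant were not a square, a solution of Pell's equation would give a nontrivial
element of `Γ₀(N)` commuting with `M`. -/
theorem isSquare_discr {N : ℕ} {M : Matrix (Fin 2) (Fin 2) ℤ} (hN : (N : ℤ) ∣ M 1 0)
    (hpos : 0 < M.trace ^ 2 - 4 * M.det)
    (hcent : ∀ g : SL(2, ℤ), (N : ℤ) ∣ g 1 0 → M * g = g * M → g = 1 ∨ g = -1) :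
    IsSquare (M.trace ^ 2 - 4 * M.det) := by
  by_contra hsq
  obtain ⟨x, y, hxy, hy⟩ := Pell.exists_of_not_isSquare hpos hsq
  rw [Matrix.trace_fin_two, Matrix.det_fin_two] at hxy hpos
  obtain ⟨g, hg⟩ : ∃ g : SL(2, ℤ), (g : Matrix (Fin 2) (Fin 2) ℤ) =
      !![x + y * (M 0 0 - M 1 1), 2 * y * M 0 1; 2 * y * M 1 0, x - y * (M 0 0 - M 1 1)] := by
    refine ⟨⟨_, ?_⟩, rfl⟩
    rw [Matrix.det_fin_two_of]
    linear_combination hxy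
  have hcomm : M * g = g * M := by
    rw [hg]
    ext i j
    fin_cases i <;> fin_cases j <;> simp [Matrix.mul_apply, Fin.sum_univ_two] <;> ring
  have h01 : 2 * y * M 0 1 = 0 ∧ 2 * y * M 1 0 = 0 ∧
      x + y * (M 0 0 - M 1 1) = x - y * (M 0 0 - M 1 1) := by
    have e01 : g 0 1 = 2 * y * M 0 1 := by simp [hg]
    have e10 : g 1 0 = 2 * y * M 1 0 := by simp [hg]
    have e00 : g 0 0 = x + y * (M 0 0 - M 1 1) := by simp [hg]
    have e11 : g 1 1 = x - y * (M 0 0 - M 1 1) := by simp [hg]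
    rw [← e01, ← e10, ← e00, ← e11]
    rcases hcent g (by rw [e10]; exact hN.mul_left _) hcomm with rfl | rfl <;> simp
  obtain ⟨h1, h2, h3⟩ := h01
  have k1 : M 0 1 = 0 := by simpa [hy] using h1
  have k3 : M 0 0 - M 1 1 = 0 := by
    have : y * (M 0 0 - M 1 1) = 0 := by linarith
    simpa [hy] using this
  have : (M 0 0 + M 1 1) ^ 2 - 4 * (M 0 0 * M 1 1 - M 0 1 * M 1 0) = 0 := by
    linear_combination (M 0 0 - M 1 1) * k3 + 4 * M 1 0 * k1
  omega

/-! ### Representatives of the conjugacy classes -/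

/-- The matrix with eigenvalue `a` on `(1, w)`, with second eigenvalue `d` and with upper right
entry `x`: the conjugate of `(a, x; 0, d)` by `(1, 0; w, 1)`. -/
def repMat (w a d x : ℤ) : Matrix (Fin 2) (Fin 2) ℤ :=
  !![a - x * w, x; (a - d) * w - x * w ^ 2, x * w + d]

theorem det_repMat (w a d x : ℤ) : (repMat w a d x).det = a * d := by
  rw [repMat, Matrix.det_fin_two_of]; ring

theorem trace_repMat (w a d x : ℤ) : (repMat w a d x).trace = a + d := by
  rw [repMat, Matrix.trace_fin_two_of]; ring

/-- A complete set of representatives for the upper right entries `x` of `repMat w a d x` modulo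
conjugation by the stabilizer of the cusp `1/w`. The parameter `b` of the trace formula is
`x / (N / w)`. -/
def entrySet (N w a d : ℕ) : Finset ℤ :=
  (Finset.Ico 0 (|(a : ℤ) - d| * (N / w : ℕ))).filter
    fun x => (N : ℤ) ∣ ((a : ℤ) - d) * w - x * w ^ 2

theorem mem_entrySet {N w a d : ℕ} {x : ℤ} : x ∈ entrySet N w a d ↔
    0 ≤ x ∧ x < |(a : ℤ) - d| * (N / w : ℕ) ∧ (N : ℤ) ∣ ((a : ℤ) - d) * w - x * w ^ 2 := by
  rw [entrySet, Finset.mem_filter, Finset.mem_Ico, and_assoc]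

/-- A divisor of a square-free number is coprime to the complementary divisor. -/
theorem exists_mul_eq_isCoprime {N w : ℕ} (hN : Squarefree N) (hw : w ∈ N.divisors) :
    0 < w ∧ 0 < N / w ∧ (N : ℤ) = w * (N / w : ℕ) ∧ IsCoprime (w : ℤ) (N / w : ℕ) := by
  have hd := Nat.dvd_of_mem_divisors hw
  have h := Nat.mul_div_cancel' hd
  have hN0 : N ≠ 0 := hN.ne_zero
  refine ⟨Nat.pos_of_mem_divisors hw, Nat.div_pos (Nat.le_of_dvd (Nat.pos_of_ne_zero hN0) hd)
    (Nat.pos_of_mem_divisors hw), by exact_mod_cast h.symm, ?_⟩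
  rw [Nat.isCoprime_iff_coprime]
  rw [← h] at hN
  exact Nat.coprime_of_squarefree_mul hN

theorem entry_eq_of_SL (g : SL(2, ℤ)) : g 0 0 * g 1 1 - g 0 1 * g 1 0 = 1 := by
  rw [← Matrix.det_fin_two]; exact g.2

/-- Each cusp of `Γ₀(N)` is equivalent to `1/w` for a divisor `w` of `N`. -/
theorem exists_smul_eq_one_div {N : ℕ} (hN : Squarefree N) {p q : ℤ} (hpq : IsCoprime p q) :
    ∃ g : SL(2, ℤ), (N : ℤ) ∣ g 1 0 ∧ ∃ w ∈ N.divisors,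
      g 0 0 * p + g 0 1 * q = 1 ∧ g 1 0 * p + g 1 1 * q = w := by
  obtain ⟨e, f, hef⟩ := hpq
  set w : ℕ := Int.gcd q N with hw
  have hwN : w ∈ N.divisors := by
    rw [Nat.mem_divisors]
    exact ⟨Int.natCast_dvd_natCast.mp (Int.gcd_dvd_right _ _), hN.ne_zero⟩
  obtain ⟨hw0, -, hNw, hcop⟩ := exists_mul_eq_isCoprime hN hwN
  set h : ℕ := N / w with hh
  have hw0' : (w : ℤ) ≠ 0 := by exact_mod_cast hw0.ne'
  obtain ⟨q', hq'⟩ : (w : ℤ) ∣ q := Int.gcd_dvd_left _ _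
  have hcop' : IsCoprime q' (h : ℤ) := by
    obtain ⟨u, v, huv⟩ : ∃ u v, q * u + (N : ℤ) * v = w := ⟨_, _, (Int.gcd_eq_gcd_ab _ _).symm⟩
    refine ⟨u, v, mul_left_cancel₀ hw0' ?_⟩
    linear_combination huv - u * hq' - v * hNw
  obtain ⟨r, t, hrt⟩ : IsCoprime q (h : ℤ) := by rw [hq']; exact hcop.mul_left hcop'
  -- `x q ≡ e - q' (mod h)`
  set x : ℤ := r * (e - q') with hx
  obtain ⟨g, hg⟩ : ∃ g : SL(2, ℤ), (g : Matrix (Fin 2) (Fin 2) ℤ) =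
      !![e - x * q, f + x * p; w * (e - x * q) - q, w * (f + x * p) + p] := by
    refine ⟨⟨_, ?_⟩, rfl⟩
    rw [Matrix.det_fin_two_of]
    linear_combination hef
  refine ⟨g, ?_, w, hwN, ?_, ?_⟩
  · refine ⟨t * (e - q'), ?_⟩
    have : g 1 0 = w * (e - x * q) - q := by simp [hg]
    rw [this, hx]
    linear_combination -(w : ℤ) * (e - q') * hrt - hq' - t * (e - q') * hNw
  · simp [hg]
    linear_combination hef
  · simp [hg]
    linear_combination (w : ℤ) * hef

/-- An integral matrix with distinct integral eigenvalues has a primitive eigenvector. -/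
theorem exists_eigenvector {M : Matrix (Fin 2) (Fin 2) ℤ} {a d : ℤ} (htr : M.trace = a + d)
    (hdet : M.det = a * d) (hne : a ≠ d) :
    ∃ p q : ℤ, IsCoprime p q ∧ M 0 0 * p + M 0 1 * q = a * p ∧ M 1 0 * p + M 1 1 * q = a * q := by
  rw [Matrix.trace_fin_two] at htr
  rw [Matrix.det_fin_two] at hdet
  obtain ⟨P, Q, hne0, h0, h1⟩ : ∃ P Q : ℤ, (P ≠ 0 ∨ Q ≠ 0) ∧
      M 0 0 * P + M 0 1 * Q = a * P ∧ M 1 0 * P + M 1 1 * Q = a * Q := by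
    by_cases hz : M 0 1 = 0 ∧ a - M 0 0 = 0
    · refine ⟨a - d, M 1 0, Or.inl (sub_ne_zero.mpr hne), ?_, ?_⟩
      · linear_combination M 1 0 * hz.1 - (a - d) * hz.2
      · linear_combination M 1 0 * htr + M 1 0 * hz.2
    · refine ⟨M 0 1, a - M 0 0, ?_, by ring, ?_⟩
      · by_contra! h
        exact hz h
      · linear_combination a * htr - hdet
  have hg : Int.gcd P Q ≠ 0 := by
    rw [Ne, Int.gcd_eq_zero_iff]
    tauto
  have hg' : (Int.gcd P Q : ℤ) ≠ 0 := by exact_mod_cast hg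
  obtain ⟨p, hp⟩ := Int.gcd_dvd_left P Q
  obtain ⟨q, hq⟩ := Int.gcd_dvd_right P Q
  have hgcd := Int.gcd_eq_gcd_ab P Q
  set g : ℤ := (Int.gcd P Q : ℤ)
  refine ⟨p, q, ⟨Int.gcdA P Q, Int.gcdB P Q, mul_left_cancel₀ hg' ?_⟩,
    mul_left_cancel₀ hg' ?_, mul_left_cancel₀ hg' ?_⟩
  · linear_combination -hgcd - Int.gcdA P Q * hp - Int.gcdB P Q * hq
  · linear_combination h0 - (M 0 0 - a) * hp - M 0 1 * hq
  · linear_combination h1 - M 1 0 * hp - (M 1 1 - a) * hq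

/-- The eigenvectors of `repMat w a d x` with eigenvalue `a` are the multiples of `(1, w)`. -/
theorem eigenvector_repMat {w a d x : ℤ} (hne : a ≠ d) {p q : ℤ}
    (h0 : (a - x * w) * p + x * q = a * p)
    (h1 : ((a - d) * w - x * w ^ 2) * p + (x * w + d) * q = a * q) : q = w * p := by
  have : (a - d) * (q - w * p) = 0 := by linear_combination w * h0 - h1
  rcases mul_eq_zero.mp this with h | h
  · exact absurd (sub_eq_zero.mp h) hne
  · linarith

theorem trace_eq_of_mul_eq {M M' : Matrix (Fin 2) (Fin 2) ℤ} {g : SL(2, ℤ)}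
    (h : M' * g = g * M) : M'.trace = M.trace := by
  have hinv : (g : Matrix (Fin 2) (Fin 2) ℤ) *
      ((g⁻¹ : SL(2, ℤ)) : Matrix (Fin 2) (Fin 2) ℤ) = 1 := by
    rw [← Matrix.SpecialLinearGroup.coe_mul, mul_inv_cancel, Matrix.SpecialLinearGroup.coe_one]
  have hinv' : ((g⁻¹ : SL(2, ℤ)) : Matrix (Fin 2) (Fin 2) ℤ) *
      (g : Matrix (Fin 2) (Fin 2) ℤ) = 1 := by
    rw [← Matrix.SpecialLinearGroup.coe_mul, inv_mul_cancel, Matrix.SpecialLinearGroup.coe_one]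
  have : M' = g * M * ((g⁻¹ : SL(2, ℤ)) : Matrix (Fin 2) (Fin 2) ℤ) := by
    rw [← h, Matrix.mul_assoc, hinv, Matrix.mul_one]
  rw [this, Matrix.trace_mul_comm, ← Matrix.mul_assoc, hinv', Matrix.one_mul]

/-- For matrices of positive trace, conjugacy up to sign is conjugacy. -/
theorem mul_eq_of_trace_pos {M M' : Matrix (Fin 2) (Fin 2) ℤ} {g : SL(2, ℤ)}
    (hM : 0 < M.trace) (hM' : 0 < M'.trace) (h : M' * g = g * M ∨ M' * g = -(g * M)) :
    M' * g = g * M := by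
  rcases h with h | h
  · exact h
  · rw [← Matrix.mul_neg] at h
    have := trace_eq_of_mul_eq h
    rw [Matrix.trace_neg] at this
    omega

/-- The representatives are hyperbolic elements of `Γ*` with trivial centralizer. -/
theorem hypTriv_of_repMat {N n : ℕ} (hn : 0 < n) (hnN : Nat.Coprime n N) {w a d : ℕ}
    (ha : 0 < a) (hd : 0 < d) (hne : a ≠ d) (had : a * d = n) {x : ℤ}
    (hx : (N : ℤ) ∣ ((a : ℤ) - d) * w - x * w ^ 2) {P : SL(2, ℝ)}
    (hP : IsScaled n (repMat w a d x) P) :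
    P ∈ GamStar N n ∧ (P : Matrix (Fin 2) (Fin 2) ℝ).IsHyperbolic ∧ TrivialCentralizer N P := by
  have hne' : (a : ℤ) ≠ d := by exact_mod_cast hne
  have hdet : (repMat w a d x).det = n := by rw [det_repMat, ← had]; push_cast; rfl
  refine ⟨(mem_GamStar_iff hn hnN).mpr ⟨_, hdet, hx, hP⟩, ?_, ?_⟩
  · rw [isHyperbolic_iff hn hP, trace_repMat, det_repMat]
    have : 0 < ((a : ℤ) - d) ^ 2 := by have := sub_ne_zero.mpr hne'; positivity
    linarith
  · rw [trivialCentralizer_iff hn hP]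
    intro g _ hc
    have htr : 0 < (repMat w a d x).trace := by rw [trace_repMat]; positivity
    have hcomm := mul_eq_of_trace_pos htr htr hc
    have hg := entry_eq_of_SL g
    have e00 := congrFun (congrFun hcomm 0) 0
    have e01 := congrFun (congrFun hcomm 0) 1
    have e10 := congrFun (congrFun hcomm 1) 0
    have e11 := congrFun (congrFun hcomm 1) 1
    simp only [Matrix.mul_apply, Fin.sum_univ_two, repMat, Matrix.of_apply, Matrix.cons_val',
      Matrix.cons_val_zero, Matrix.cons_val_one, Matrix.cons_val_fin_one] at e00 e01 e10 e11
    -- `g` preserves the line of `(1, w)`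
    have hline : g 1 0 + g 1 1 * w = w * (g 0 0 + g 0 1 * w) := by
      refine eigenvector_repMat (a := a) (d := d) (x := x) hne' ?_ ?_
      · linear_combination e00 + w * e01
      · linear_combination e10 + w * e11
    have hunit : (g 0 0 + g 0 1 * w) * (g 1 1 - g 0 1 * w) = 1 := by
      linear_combination hg + g 0 1 * hline
    have h01 : g 0 1 = 0 := by
      have hee : g 0 0 + g 0 1 * w = g 1 1 - g 0 1 * w := Int.eq_of_mul_eq_one hunit
      have : ((a : ℤ) - d) * g 0 1 = 0 := by linear_combination e01 + x * hee
      rcases mul_eq_zero.mp this with h | h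
      · exact absurd (sub_eq_zero.mp h) hne'
      · exact h
    rw [h01] at hunit hline
    simp only [zero_mul, add_zero, sub_zero] at hunit hline
    have hee : g 0 0 = g 1 1 := Int.eq_of_mul_eq_one hunit
    have h10 : g 1 0 = 0 := by rw [hee] at hline; linarith
    rw [hee] at hunit
    rcases Int.isUnit_iff.mp (IsUnit.of_mul_eq_one _ hunit) with h | h
    · left
      ext i j
      fin_cases i <;> fin_cases j <;> simp [h, h01, h10, hee]
    · right
      ext i j
      fin_cases i <;> fin_cases j <;> simp [h, h01, h10, hee]

/-- Conjugate representatives have the same eigenvalues; with the same order of the eigenvalues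
they are equal. -/
theorem eq_of_conj_repMat {N n : ℕ} (hN : Squarefree N) (hn : 0 < n) {w a d w' a' d' : ℕ}
    (hw : w ∈ N.divisors) (hw' : w' ∈ N.divisors) (ha : 0 < a) (ha' : 0 < a') (hne : a ≠ d)
    (had : a * d = n) (had' : a' * d' = n) {x x' : ℤ}
    (hx : x ∈ entrySet N w a d) (hx' : x' ∈ entrySet N w' a' d') {P P' : SL(2, ℝ)}
    (hP : IsScaled n (repMat w a d x) P) (hP' : IsScaled n (repMat w' a' d' x') P')
    (hc : Conj N P P') :
    (a = a' ∧ d = d' ∧ w = w' ∧ x = x') ∨ (a = d' ∧ d = a') := by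
  obtain ⟨g, hg10, hg⟩ := (conj_iff hn hP hP').mp hc
  have hcomm := mul_eq_of_trace_pos (by rw [trace_repMat]; positivity)
    (by rw [trace_repMat]; positivity) hg
  have htr := trace_eq_of_mul_eq hcomm
  rw [trace_repMat, trace_repMat] at htr
  have hprod : (a : ℤ) * d = a' * d' := by exact_mod_cast had.trans had'.symm
  have hsplit : ((a : ℤ) - a') * (a - d') = 0 := by
    linear_combination -hprod - (a : ℤ) * htr
  rcases mul_eq_zero.mp hsplit with h | h
  swap
  · right
    have : (a : ℤ) = d' := by linarith
    have : (d : ℤ) = a' := by linarith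
    constructor <;> omega
  left
  have haa : a = a' := by omega
  have hdd : d = d' := by omega
  subst haa hdd
  have hne' : (a : ℤ) ≠ d := by exact_mod_cast hne
  have hdet := entry_eq_of_SL g
  have e00 := congrFun (congrFun hcomm 0) 0
  have e01 := congrFun (congrFun hcomm 0) 1
  have e10 := congrFun (congrFun hcomm 1) 0
  have e11 := congrFun (congrFun hcomm 1) 1
  simp only [Matrix.mul_apply, Fin.sum_univ_two, repMat, Matrix.of_apply, Matrix.cons_val',
    Matrix.cons_val_zero, Matrix.cons_val_one, Matrix.cons_val_fin_one] at e00 e01 e10 e11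
  have hline : g 1 0 + g 1 1 * w = w' * (g 0 0 + g 0 1 * w) := by
    refine eigenvector_repMat (a := a) (d := d) (x := x') hne' ?_ ?_
    · linear_combination e00 + w * e01
    · linear_combination e10 + w * e11
  have hunit : (g 0 0 + g 0 1 * w) * (g 1 1 - g 0 1 * w') = 1 := by
    linear_combination hdet + g 0 1 * hline
  obtain ⟨hw0, hh0, hNw, hcop⟩ := exists_mul_eq_isCoprime hN hw
  obtain ⟨hw0', hh0', hNw', hcop'⟩ := exists_mul_eq_isCoprime hN hw'
  have hee : g 0 0 + g 0 1 * w = g 1 1 - g 0 1 * w' := Int.eq_of_mul_eq_one hunit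
  have hsq : (g 0 0 + g 0 1 * w) * (g 0 0 + g 0 1 * w) = 1 := by
    nth_rw 2 [hee]; exact hunit
  have hww : w = w' := by
    have hgN : IsCoprime (g 1 1) (N : ℤ) := by
      obtain ⟨k, hk⟩ := hg10
      exact ⟨g 0 0, -(g 0 1 * k), by linear_combination hdet + g 0 1 * hk⟩
    have d1 : (w : ℤ) ∣ w' := by
      obtain ⟨k, hk⟩ := hg10
      refine ⟨((N / w : ℕ) * k + g 1 1) * (g 0 0 + g 0 1 * w), ?_⟩
      linear_combination -(w' : ℤ) * hsq - (g 0 0 + g 0 1 * w) * hline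
        + (g 0 0 + g 0 1 * w) * hk + (g 0 0 + g 0 1 * w) * k * hNw
    have d2 : (w' : ℤ) ∣ w := by
      have h1 : (w' : ℤ) ∣ g 1 1 * w := by
        obtain ⟨k, hk⟩ := hg10
        refine ⟨(g 0 0 + g 0 1 * w) - (N / w' : ℕ) * k, ?_⟩
        linear_combination hline - hk - k * hNw'
      have hcw : IsCoprime (w' : ℤ) (g 1 1) :=
        (hgN.symm.of_isCoprime_of_dvd_left ⟨_, hNw'⟩)
      exact hcw.dvd_of_dvd_mul_left h1
    exact Nat.dvd_antisymm (Int.natCast_dvd_natCast.mp d1) (Int.natCast_dvd_natCast.mp d2)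
  subst hww
  refine ⟨rfl, rfl, rfl, ?_⟩
  rw [mem_entrySet] at hx hx'
  -- the conjugation is a translation by a multiple of the width
  have hdvd : ((N / w : ℕ) : ℤ) ∣ g 0 1 := by
    obtain ⟨k, hk⟩ := hg10
    have h1 : (w : ℤ) * (g 0 1 * w + (N / w : ℕ) * k) = 0 := by
      linear_combination hline + (w : ℤ) * hee - hk - k * hNw
    have hw0'' : (w : ℤ) ≠ 0 := by exact_mod_cast hw0.ne'
    have h2 := (mul_eq_zero.mp h1).resolve_left hw0''
    exact hcop.symm.dvd_of_dvd_mul_right ⟨-k, by linear_combination h2⟩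
  obtain ⟨j, hj⟩ := hdvd
  have hdiff : |(a : ℤ) - d| * (N / w : ℕ) ∣ x' - x := by
    have h1 : x' - x = ((a : ℤ) - d) * (N / w : ℕ) * (-j * (g 0 0 + g 0 1 * w)) := by
      linear_combination (g 0 0 + g 0 1 * w) * e01 - (x' - x) * hsq +
        (g 0 0 + g 0 1 * w) * x' * hee
        - ((a : ℤ) - d) * (g 0 0 + g 0 1 * w) * hj
    rw [h1]
    exact (mul_dvd_mul_right ((abs_dvd _ _).mpr dvd_rfl) _).mul_right _
  have hlt : |x' - x| < |(a : ℤ) - d| * (N / w : ℕ) := by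
    rw [abs_lt]
    constructor <;> linarith [hx.1, hx.2.1, hx'.1, hx'.2.1]
  have := Int.eq_zero_of_abs_lt_dvd hdiff hlt
  linarith

/-- The structure of the hyperbolic elements of `Γ*` with trivial centralizer: up to sign they
come from integral matrices with distinct positive integral eigenvalues. -/
theorem exists_eigenvalues {N n : ℕ} (hn : 0 < n) (hnN : Nat.Coprime n N) (P : HypTriv N n) :
    ∃ (M : Matrix (Fin 2) (Fin 2) ℤ) (a d : ℕ), 0 < a ∧ 0 < d ∧ a ≠ d ∧ a * d = n ∧
      (N : ℤ) ∣ M 1 0 ∧ M.det = (a : ℤ) * d ∧ M.trace = (a : ℤ) + d ∧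
      (IsScaled n M P.1 ∨ IsScaled n M (-P.1)) := by
  obtain ⟨P, hPs, hPh, hPc⟩ := P
  obtain ⟨M₀, hdet₀, hN₀, hM₀⟩ := (mem_GamStar_iff hn hnN).mp hPs
  rw [isHyperbolic_iff hn hM₀] at hPh
  rw [trivialCentralizer_iff hn hM₀] at hPc
  have hsq₀ := isSquare_discr hN₀ hPh fun g hg hc => hPc g hg (Or.inl hc)
  have hn' : (0 : ℤ) < n := by exact_mod_cast hn
  -- choose the sign so that the trace is positive
  obtain ⟨M, hdet, hNM, htr, hsq, hpos, hM⟩ : ∃ M : Matrix (Fin 2) (Fin 2) ℤ, M.det = n ∧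
      (N : ℤ) ∣ M 1 0 ∧ 0 ≤ M.trace ∧ IsSquare (M.trace ^ 2 - 4 * M.det) ∧
      0 < M.trace ^ 2 - 4 * M.det ∧ (IsScaled n M P ∨ IsScaled n M (-P)) := by
    rcases le_total 0 M₀.trace with h | h
    · exact ⟨M₀, hdet₀, hN₀, h, hsq₀, hPh, Or.inl hM₀⟩
    · have hdn : (-M₀).det = M₀.det := by simp [Matrix.det_fin_two]
      refine ⟨-M₀, hdn.trans hdet₀, by simpa using hN₀, ?_, ?_, ?_, Or.inr hM₀.neg⟩
      · rw [Matrix.trace_neg]; linarith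
      · rw [Matrix.trace_neg, hdn, neg_sq]; exact hsq₀
      · rw [Matrix.trace_neg, hdn, neg_sq]; exact hPh
  obtain ⟨r, hr⟩ := hsq
  rw [hdet] at hr hpos
  set t := M.trace with ht
  have hpar : (2 : ℤ) ∣ t + |r| := by
    have h1 : (2 : ℤ) ∣ (t + |r|) * (t + |r|) := by
      refine ⟨|r| * |r| + t * |r| + 2 * n, ?_⟩
      linear_combination hr - abs_mul_abs_self r
    rcases Int.prime_two.dvd_or_dvd h1 with h | h <;> exact h
  obtain ⟨a, ha⟩ := hpar
  have hrr : |r| * |r| = t ^ 2 - 4 * n := by rw [abs_mul_abs_self, hr]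
  have hrpos : 0 < |r| := by
    rw [abs_pos]; rintro rfl; linarith
  have hlt : |r| < t := by nlinarith
  have hapos : 0 < a := by linarith
  have hdpos : 0 < t - a := by linarith
  have hprod : a * (t - a) = n := by
    have h4 : |r| = 2 * a - t := by linarith
    rw [h4] at hrr
    linarith
  obtain ⟨a', rfl⟩ := Int.eq_ofNat_of_zero_le hapos.le
  obtain ⟨d', hd'⟩ := Int.eq_ofNat_of_zero_le hdpos.le
  refine ⟨M, a', d', by exact_mod_cast hapos, ?_, ?_, ?_, hNM, ?_, ?_, hM⟩
  · rw [hd'] at hdpos; exact_mod_cast hdpos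
  · rintro rfl
    linarith
  · rw [hd'] at hprod; exact_mod_cast hprod
  · rw [hdet, ← hprod, hd']
  · linarith

/-- Each hyperbolic matrix with eigenvalues `a`, `d` is conjugate to a representative. -/
theorem exists_conj_repMat {N : ℕ} (hN : Squarefree N) {M : Matrix (Fin 2) (Fin 2) ℤ}
    {a d : ℕ} (hne : a ≠ d)
    (hNM : (N : ℤ) ∣ M 1 0) (hdet : M.det = (a : ℤ) * d) (htr : M.trace = (a : ℤ) + d) :
    ∃ w ∈ N.divisors, ∃ x ∈ entrySet N w a d, ∃ g : SL(2, ℤ), (N : ℤ) ∣ g 1 0 ∧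
      repMat w a d x * g = g * M := by
  have hne' : (a : ℤ) ≠ d := by exact_mod_cast hne
  obtain ⟨p, q, hpq, hp, hq⟩ := exists_eigenvector htr hdet hne'
  obtain ⟨g, hg10, w, hw, h1, h2⟩ := exists_smul_eq_one_div hN hpq
  obtain ⟨hw0, hh0, hNw, hcop⟩ := exists_mul_eq_isCoprime hN hw
  have hg := entry_eq_of_SL g
  obtain ⟨M', hM'⟩ : ∃ M' : Matrix (Fin 2) (Fin 2) ℤ, M' * g = g * M := by
    refine ⟨g * M * ((g⁻¹ : SL(2, ℤ)) : Matrix (Fin 2) (Fin 2) ℤ), ?_⟩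
    rw [Matrix.mul_assoc, ← Matrix.SpecialLinearGroup.coe_mul, inv_mul_cancel,
      Matrix.SpecialLinearGroup.coe_one, Matrix.mul_one]
  have htr' := (trace_eq_of_mul_eq hM').trans htr
  rw [Matrix.trace_fin_two] at htr'
  have e00 := congrFun (congrFun hM' 0) 0
  have e01 := congrFun (congrFun hM' 0) 1
  have e10 := congrFun (congrFun hM' 1) 0
  have e11 := congrFun (congrFun hM' 1) 1
  simp only [Matrix.mul_apply, Fin.sum_univ_two] at e00 e01 e10 e11
  have k0 : M' 0 0 + M' 0 1 * w = a := by
    linear_combination p * e00 + q * e01 - M' 0 0 * h1 - M' 0 1 * h2 + g 0 0 * hp + g 0 1 * hq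
      + (a : ℤ) * h1
  have k1 : M' 1 0 + M' 1 1 * w = a * w := by
    linear_combination p * e10 + q * e11 - M' 1 0 * h1 - M' 1 1 * h2 + g 1 0 * hp + g 1 1 * hq
      + (a : ℤ) * h2
  obtain ⟨x₀, hx₀⟩ : ∃ x₀, M' 0 1 = x₀ := ⟨_, rfl⟩
  rw [hx₀] at k0
  have hrep : M' = repMat w a d x₀ := by
    ext i j
    fin_cases i <;> fin_cases j <;> simp [repMat]
    · linear_combination k0
    · exact hx₀
    · linear_combination k1 - (w : ℤ) * (htr' - k0)
    · linear_combination htr' - k0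
  have hN₀ : (N : ℤ) ∣ ((a : ℤ) - d) * w - x₀ * w ^ 2 := by
    have h10 : M' 1 0 = (g 1 0 * M 0 0 + g 1 1 * M 1 0) * g 1 1 -
        (g 1 0 * M 0 1 + g 1 1 * M 1 1) * g 1 0 := by
      linear_combination -M' 1 0 * hg + g 1 1 * e10 - g 1 0 * e11
    have h10' : M' 1 0 = ((a : ℤ) - d) * w - x₀ * w ^ 2 := by rw [hrep]; rfl
    rw [← h10', h10]
    exact dvd_sub ((dvd_add (hg10.mul_right _) (hNM.mul_left _)).mul_right _) (hg10.mul_left _)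
  -- move the entry to the fundamental interval by a translation
  set B : ℤ := |(a : ℤ) - d| * (N / w : ℕ) with hB
  have hBpos : 0 < B := by
    have : 0 < |(a : ℤ) - d| := abs_pos.mpr (sub_ne_zero.mpr hne')
    have : (0 : ℤ) < (N / w : ℕ) := by exact_mod_cast hh0
    positivity
  obtain ⟨e, he⟩ : ∃ e : ℤ, |(a : ℤ) - d| = e * (a - d) := by
    rcases abs_choice ((a : ℤ) - d) with h | h
    · exact ⟨1, by rw [h, one_mul]⟩
    · exact ⟨-1, by rw [h]; ring⟩
  set k : ℤ := x₀ / B with hk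
  have hmod : x₀ % B = x₀ - B * k := by rw [hk, Int.emod_def]
  set m : ℤ := e * k * (N / w : ℕ) with hm
  have hx : x₀ % B = x₀ + m * (d - a) := by
    rw [hmod, hm, hB, he]; ring
  obtain ⟨T, hT⟩ : ∃ T : SL(2, ℤ), (T : Matrix (Fin 2) (Fin 2) ℤ) =
      !![1 - m * w, m; -(w ^ 2 * m), 1 + w * m] := by
    refine ⟨⟨_, ?_⟩, rfl⟩
    rw [Matrix.det_fin_two_of]
    ring
  have hNm : (N : ℤ) ∣ w ^ 2 * m := ⟨w * e * k, by rw [hm, hNw]; ring⟩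
  refine ⟨w, hw, x₀ % B, mem_entrySet.mpr ⟨Int.emod_nonneg _ hBpos.ne', Int.emod_lt_of_pos _ hBpos,
    ?_⟩, T * g, ?_, ?_⟩
  · rw [hx, show ((a : ℤ) - d) * w - (x₀ + m * (d - a)) * w ^ 2 =
      ((a : ℤ) - d) * w - x₀ * w ^ 2 - w ^ 2 * m * (d - a) by ring]
    exact dvd_sub hN₀ (hNm.mul_right _)
  · have : (T * g) 1 0 = -(w ^ 2 * m) * g 0 0 + (1 + w * m) * g 1 0 := by
      rw [Matrix.SpecialLinearGroup.coe_mul, hT]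
      simp [Matrix.mul_apply, Fin.sum_univ_two]
    rw [this]
    exact dvd_add (hNm.neg_right.mul_right _) (hg10.mul_left _)
  · have hTT : repMat w a d (x₀ % B) * T = T * repMat w a d x₀ := by
      rw [hx, hT]
      ext i j
      fin_cases i <;> fin_cases j <;> simp [repMat] <;> ring
    rw [Matrix.SpecialLinearGroup.coe_mul, ← Matrix.mul_assoc, hTT, Matrix.mul_assoc,
      Matrix.mul_assoc, ← hM', hrep]

/-! ### The explicit side -/

/-- The parameters `b` are the quotients `x / (N / w)` of the upper right entries `x` of the
representatives. -/
theorem bSet_eq_image {N w a d : ℕ} (hN : Squarefree N) (hw : w ∈ N.divisors) :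
    bSet N w a d = (fun x : ℤ => (x : ℚ) / ((N / w : ℕ) : ℚ)) '' (entrySet N w a d : Set ℤ) := by
  obtain ⟨hw0, hh0, hNw, -⟩ := exists_mul_eq_isCoprime hN hw
  set h : ℕ := N / w
  have hwQ : (w : ℚ) ≠ 0 := by exact_mod_cast hw0.ne'
  have hhQ : (0 : ℚ) < h := by exact_mod_cast hh0
  have hNQ : (N : ℚ) = w * h := by exact_mod_cast hNw
  ext b
  simp only [bSet, Set.mem_ofPred_eq, Set.mem_image, Finset.mem_coe, mem_entrySet]
  constructor
  · rintro ⟨hb0, hb1, ⟨k, hk⟩, C, hC, hNC⟩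
    have hbk : b = k / h := by
      rw [hNQ] at hk
      field_simp at hk ⊢
      linear_combination hk
    refine ⟨k, ⟨?_, ?_, ?_⟩, hbk.symm⟩
    · rw [hbk, le_div_iff₀ hhQ, zero_mul] at hb0
      exact_mod_cast hb0
    · rw [hbk, div_lt_iff₀ hhQ] at hb1
      exact_mod_cast hb1
    · have : ((a : ℤ) - d) * w - k * w ^ 2 = C := by
        have : ((a : ℚ) - d) * w - k * w ^ 2 = C := by
          rw [← hC, hbk, hNQ]
          field_simp
        exact_mod_cast this
      rw [this]
      exact hNC
  · rintro ⟨x, ⟨hx0, hx1, hx2⟩, rfl⟩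
    refine ⟨?_, ?_, ⟨x, ?_⟩, ((a : ℤ) - d) * w - x * w ^ 2, ?_, hx2⟩
    · have : (0 : ℚ) ≤ x := by exact_mod_cast hx0
      positivity
    · rw [div_lt_iff₀ hhQ]
      exact_mod_cast hx1
    · rw [hNQ]
      field_simp
    · rw [hNQ]
      push_cast
      field_simp

theorem injective_div_width {N w : ℕ} (hh : 0 < N / w) :
    Function.Injective fun x : ℤ => (x : ℚ) / ((N / w : ℕ) : ℚ) := by
  intro x y hxy
  have hhQ : ((N / w : ℕ) : ℚ) ≠ 0 := by exact_mod_cast hh.ne'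
  have := (div_left_inj' hhQ).mp hxy
  exact_mod_cast this

theorem card_entrySet {N w : ℕ} (hN : Squarefree N) (hw : w ∈ N.divisors) (a d : ℕ) :
    ((entrySet N w a d).card : ℤ) = |(a : ℤ) - d| := by
  obtain ⟨hw0, hh0, hNw, r, t, hrt⟩ := exists_mul_eq_isCoprime hN hw
  set h : ℕ := N / w with hh
  have hwZ : (w : ℤ) ≠ 0 := by exact_mod_cast hw0.ne'
  have hhZ : (0 : ℤ) < h := by exact_mod_cast hh0
  have hset : entrySet N w a d = (Finset.Ico 0 (|(a : ℤ) - d| * h)).filter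
      fun x => x ≡ r * (a - d) [ZMOD h] := by
    rw [entrySet]
    refine Finset.filter_congr fun x _ => ?_
    rw [Int.modEq_iff_dvd, hNw, show ((a : ℤ) - d) * w - x * w ^ 2 = w * ((a - d) - x * w) by ring,
      mul_dvd_mul_iff_left hwZ]
    constructor
    · rintro ⟨k, hk⟩
      exact ⟨r * k - t * x, by linear_combination r * hk + x * hrt⟩
    · rintro ⟨k, hk⟩
      exact ⟨w * k + t * (a - d), by linear_combination w * hk - ((a : ℤ) - d) * hrt⟩
  rw [hset, Int.Ico_filter_modEq_card _ _ hhZ]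
  have hhQ : (h : ℚ) ≠ 0 := by exact_mod_cast hh0.ne'
  have : (((|(a : ℤ) - d| * h : ℤ) - (r * (a - d) : ℤ) : ℚ)) / (h : ℤ) =
      ((0 : ℤ) - (r * (a - d) : ℤ) : ℚ) / (h : ℤ) + (|(a : ℤ) - d| : ℤ) := by
    rw [Int.cast_mul, Int.cast_natCast]
    field_simp
    ring
  rw [this, Int.ceil_add_intCast, add_sub_cancel_left, max_eq_left (abs_nonneg _)]

theorem ncard_bSet {N w : ℕ} (hN : Squarefree N) (hw : w ∈ N.divisors) (a d : ℕ) :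
    ((bSet N w a d).ncard : ℤ) = |(a : ℤ) - d| := by
  obtain ⟨-, hh0, -, -⟩ := exists_mul_eq_isCoprime hN hw
  rw [bSet_eq_image hN hw, Set.ncard_image_of_injective _ (injective_div_width hh0),
    Set.ncard_coe_finset, card_entrySet hN hw]

theorem nu_eq_card {N : ℕ} (hN : Squarefree N) : nu N = N.divisors.card := by
  rw [nu, Finset.card_eq_sum_ones]
  refine Finset.sum_congr rfl fun w hw => ?_
  obtain ⟨-, -, -, h⟩ := exists_mul_eq_isCoprime hN hw
  rw [Nat.isCoprime_iff_coprime] at h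
  rw [h, Nat.totient_one]

/-- The width of the cusp `1/w`. -/
theorem width_divisor {N w : ℕ} (hN : Squarefree N) (hw : w ∈ N.divisors) :
    width N w = N / w := by
  obtain ⟨hw0, -, hNw, hcop⟩ := exists_mul_eq_isCoprime hN hw
  have hg : Int.gcd ((w : ℤ) ^ 2) N = w := by
    rw [hNw, sq, Int.gcd_mul_left, Int.isCoprime_iff_gcd_eq_one.mp hcop]
    simp
  rw [width, hg]

/-- The second fixed point `p₂/q₂` of a representative, with `Δ` the determinant of the two fixed
points `1/w` and `p₂/q₂`. The product `h₁ h₂ Δ²`, with `h₁` and `h₂` the widths of the two cusps, is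
the argument of the logarithm in the trace formula. -/
theorem exists_second_fixed_point {N w a d : ℕ} (hN : Squarefree N) (hw : w ∈ N.divisors)
    (hne : a ≠ d) (x : ℤ) :
    ∃ p₂ q₂ Δ : ℤ, IsCoprime p₂ q₂ ∧ Δ = 1 * q₂ - p₂ * w ∧ Δ ≠ 0 ∧
      ((a : ℤ) - x * w) * p₂ + x * q₂ = d * p₂ ∧
      (((a : ℤ) - d) * w - x * w ^ 2) * p₂ + (x * w + d) * q₂ = d * q₂ ∧
      Real.log (width N w * (width N q₂ * Δ ^ 2)) =
        |(a : ℝ) - d| * logTerm N w a d ((x : ℚ) / ((N / w : ℕ) : ℚ)) := by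
  obtain ⟨hw0, hh0, hNw, -⟩ := exists_mul_eq_isCoprime hN hw
  have hwid := width_divisor hN hw
  set h : ℕ := N / w
  have hwQ : (w : ℚ) ≠ 0 := by exact_mod_cast hw0.ne'
  have hhQ : (h : ℚ) ≠ 0 := by exact_mod_cast hh0.ne'
  have hNQ : (N : ℚ) = w * h := by exact_mod_cast hNw
  have hNR : (N : ℝ) = w * h := by exact_mod_cast hNw
  have hne' : (a : ℤ) - d ≠ 0 := sub_ne_zero.mpr (by exact_mod_cast hne)
  have hneR : (a : ℝ) - d ≠ 0 := sub_ne_zero.mpr (by exact_mod_cast hne)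
  have hwZ : (w : ℤ) ≠ 0 := by exact_mod_cast hw0.ne'
  set C : ℤ := ((a : ℤ) - d) * w - x * w ^ 2 with hC
  have hentry : entryC N w a d ((x : ℚ) / h) = C := by
    have : ((a : ℚ) - d) * w - (x : ℚ) / h * w * N = (C : ℤ) := by
      rw [hNQ, hC]
      push_cast
      field_simp
    rw [entryC, this, Rat.num_intCast]
  have hell : ell N w a d ((x : ℚ) / h) = Int.gcd C (x * w) := by
    have : (x : ℚ) / h * N = ((x * w : ℤ) : ℚ) := by
      rw [hNQ]
      push_cast
      field_simp
    rw [ell, hentry, this, Rat.num_intCast]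
  have hg0 : Int.gcd C (x * w) ≠ 0 := by
    rw [Ne, Int.gcd_eq_zero_iff]
    rintro ⟨h1, h2⟩
    have : ((a : ℤ) - d) * w = 0 := by linear_combination h1 + w * h2
    exact (mul_ne_zero hne' hwZ) this
  obtain ⟨q₂, hq₂⟩ := Int.gcd_dvd_left C (x * w)
  obtain ⟨p, hp⟩ := Int.gcd_dvd_right C (x * w)
  have hgcd := Int.gcd_eq_gcd_ab C (x * w)
  obtain ⟨ℓ, hℓ⟩ : ∃ ℓ : ℕ, Int.gcd C (x * w) = ℓ := ⟨_, rfl⟩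
  rw [hℓ] at hg0 hq₂ hp hgcd hell
  have hℓZ : (ℓ : ℤ) ≠ 0 := by exact_mod_cast hg0
  have hℓR : (ℓ : ℝ) ≠ 0 := by exact_mod_cast hg0
  have hΔ : (ℓ : ℤ) * (1 * q₂ - -p * w) = (a - d) * w := by
    linear_combination -hq₂ - w * hp
  refine ⟨-p, q₂, 1 * q₂ - -p * w, ?_, rfl, ?_, mul_left_cancel₀ hℓZ ?_,
    mul_left_cancel₀ hℓZ ?_, ?_⟩
  · refine IsCoprime.neg_left ⟨Int.gcdB C (x * w), Int.gcdA C (x * w), mul_left_cancel₀ hℓZ ?_⟩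
    linear_combination -hgcd - Int.gcdB C (x * w) * hp - Int.gcdA C (x * w) * hq₂
  · intro h0
    rw [h0, mul_zero] at hΔ
    exact (mul_ne_zero hne' hwZ) hΔ.symm
  · linear_combination ((a : ℤ) - x * w - d) * hp - x * hq₂ + x * hC
  · linear_combination C * hp - x * w * hq₂
  · have hratio : lcmRatio N w a d ((x : ℚ) / h) = width N q₂ / (ℓ : ℝ) ^ 2 := by
      rw [lcmRatio, hentry, hell]
      split_ifs with hC0
      · have hq0 : q₂ = 0 := by
          rw [hC0] at hq₂
          exact (mul_eq_zero.mp hq₂.symm).resolve_left hℓZ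
        have hN0 : 0 < N := Nat.pos_of_ne_zero hN.ne_zero
        have : width N q₂ = 1 := by
          rw [width, hq0]
          simp [Nat.div_self hN0]
        rw [this, Nat.cast_one]
      · have hdiv : C / (ℓ : ℤ) = q₂ := by
          rw [hq₂, Int.mul_ediv_cancel_left _ hℓZ]
        have hgl : (Int.gcd (q₂ ^ 2) N : ℝ) * (Int.lcm (q₂ ^ 2) N : ℝ) = (q₂ : ℝ) ^ 2 * N := by
          have h1 := Int.gcd_mul_lcm (q₂ ^ 2) (N : ℤ)
          have h2 : ((Int.gcd (q₂ ^ 2) N * Int.lcm (q₂ ^ 2) N : ℕ) : ℤ) = q₂ ^ 2 * N := by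
            rw [h1, Nat.cast_mul, Int.natCast_natAbs, abs_of_nonneg (sq_nonneg _),
              Int.natAbs_natCast]
          exact_mod_cast h2
        have hwg : (width N q₂ : ℝ) * (Int.gcd (q₂ ^ 2) N : ℝ) = N := by
          exact_mod_cast width_mul_gcd N q₂
        have hgpos : (Int.gcd (q₂ ^ 2) N : ℝ) ≠ 0 := by
          have : 0 < Int.gcd (q₂ ^ 2) N :=
            Int.gcd_pos_of_ne_zero_right _ (by exact_mod_cast hN.ne_zero)
          exact_mod_cast this.ne'
        have hCR : (C : ℝ) = ℓ * q₂ := by exact_mod_cast hq₂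
        have hCR0 : (C : ℝ) ≠ 0 := by exact_mod_cast hC0
        have hq0 : (q₂ : ℝ) ≠ 0 := by
          intro h0
          rw [h0, mul_zero] at hCR
          exact hCR0 hCR
        rw [hdiv, hCR, div_eq_div_iff (by positivity) (by positivity)]
        apply mul_left_cancel₀ hgpos
        linear_combination (ℓ : ℝ) ^ 2 * hgl - (ℓ : ℝ) ^ 2 * (q₂ : ℝ) ^ 2 * hwg
    have hΔR : ((1 * q₂ - -p * w : ℤ) : ℝ) = ((a : ℝ) - d) * w / ℓ := by
      rw [eq_div_iff hℓR, mul_comm]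
      exact_mod_cast hΔ
    rw [logTerm, hratio, mul_div_cancel₀ _ (abs_ne_zero.mpr hneR), hΔR, hwid, hNR]
    congr 1
    field_simp

/-- The asymptotics of the truncated integral of a representative, with fixed points `1/w` and
`p₂/q₂`. -/
theorem tendsto_integral_repMat {s : ℂ} (hs : 1 < s.re) {N n : ℕ} (hN : Squarefree N) {w a d : ℕ}
    (hw : w ∈ N.divisors) (ha : 0 < a) (hd : 0 < d) (hne : a ≠ d) (had : a * d = n) (x : ℤ)
    {P : SL(2, ℝ)} (hP : IsScaled n (repMat w a d x) P) :
    Filter.Tendsto (fun Y : ℝ => (∫ z in thickPart N Y, kernel s z (P • z)) -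
      (((2 * Real.log Y + |(a : ℝ) - d| * logTerm N w a d ((x : ℚ) / ((N / w : ℕ) : ℚ)) : ℝ) : ℂ) *
        (((√(n : ℝ) : ℝ) : ℂ) * gfun s (Real.log ((a : ℝ) / d)) / ((|(a : ℝ) - d| : ℝ) : ℂ)) +
        ∫ t in Set.Ioi (1 : ℝ), tailIntegrand s n a d t)) Filter.atTop (nhds 0) := by
  obtain ⟨p₂, q₂, Δ, hcop, hΔ, hΔ0, h0, h1, hlog⟩ := exists_second_fixed_point hN hw hne x
  have h0' : ((a : ℝ) - x * w) * p₂ + x * q₂ = d * p₂ := by exact_mod_cast h0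
  have h1' : (((a : ℝ) - d) * w - x * w ^ 2) * p₂ + (x * w + d) * q₂ = d * q₂ := by
    exact_mod_cast h1
  rw [← hlog]
  refine (tendsto_integral_thickPart hs hN.ne_zero ha hd hne had (p₁ := 1) (q₁ := w)
    isCoprime_one_left hcop hΔ hΔ0 ?_ ?_).2
  · rw [hP]
    ext i
    fin_cases i <;> simp [Matrix.mulVec, dotProduct, Fin.sum_univ_two, repMat] <;> ring
  · rw [hP]
    ext i
    fin_cases i <;> simp [Matrix.mulVec, dotProduct, Fin.sum_univ_two, repMat]
    · linear_combination (√(n : ℝ))⁻¹ * h0'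
    · linear_combination (√(n : ℝ))⁻¹ * h1'

/-- Absolute convergence of the truncated integrals. -/
theorem integrableOn_kernel_thickPart {s : ℂ} (hs : 1 < s.re) {N n : ℕ} (hN : N ≠ 0) (hn : 0 < n)
    (hnN : Nat.Coprime n N) (P : HypTriv N n) {Y : ℝ} (hY : 0 < Y) :
    IntegrableOn (fun z : ℍ => kernel s z (P.1 • z)) (thickPart N Y) := by
  obtain ⟨M, a, d, ha, hd, hne, had, -, hdet, htr, hM⟩ := exists_eigenvalues hn hnN P
  have hne' : (a : ℤ) ≠ d := by exact_mod_cast hne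
  obtain ⟨p₁, q₁, hc₁, h10, h11⟩ := exists_eigenvector htr hdet hne'
  obtain ⟨p₂, q₂, hc₂, h20, h21⟩ := exists_eigenvector (htr.trans (add_comm _ _))
    (hdet.trans (mul_comm _ _)) hne'.symm
  have hΔ0 : p₁ * q₂ - p₂ * q₁ ≠ 0 := by
    intro h0
    -- proportional eigenvectors have equal eigenvalues
    have k1 : ((a : ℤ) - d) * (p₁ * p₂) = 0 := by
      linear_combination -p₂ * h10 + p₁ * h20 - M 0 1 * h0
    have k2 : ((a : ℤ) - d) * (q₁ * q₂) = 0 := by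
      linear_combination -q₂ * h11 + q₁ * h21 + M 1 0 * h0
    have k1' := (mul_eq_zero.mp k1).resolve_left (sub_ne_zero.mpr hne')
    have k2' := (mul_eq_zero.mp k2).resolve_left (sub_ne_zero.mpr hne')
    have hzz : p₁ * q₂ = 0 := by
      have : (p₁ * q₂) * (p₁ * q₂) = 0 := by
        linear_combination p₁ * q₂ * h0 + k1' * (q₁ * q₂)
      exact mul_self_eq_zero.mp this
    have hzz' : p₂ * q₁ = 0 := by linarith
    obtain ⟨u, v, huv⟩ := hc₁
    obtain ⟨u', v', huv'⟩ := hc₂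
    have : (1 : ℤ) = 0 := by
      linear_combination -huv - (u * p₁ + v * q₁) * huv' + u * u' * k1' + v * v' * k2' +
        u * v' * hzz + v * u' * hzz'
    norm_num at this
  have hmain : ∀ Q : SL(2, ℝ), IsScaled n M Q →
      IntegrableOn (fun z : ℍ => kernel s z (Q • z)) (thickPart N Y) := by
    intro Q hQ
    have h10' : (M 0 0 : ℝ) * p₁ + M 0 1 * q₁ = a * p₁ := by exact_mod_cast h10
    have h11' : (M 1 0 : ℝ) * p₁ + M 1 1 * q₁ = a * q₁ := by exact_mod_cast h11
    have h20' : (M 0 0 : ℝ) * p₂ + M 0 1 * q₂ = d * p₂ := by exact_mod_cast h20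
    have h21' : (M 1 0 : ℝ) * p₂ + M 1 1 * q₂ = d * q₂ := by exact_mod_cast h21
    refine (tendsto_integral_thickPart hs hN ha hd hne had hc₁ hc₂ rfl hΔ0 ?_ ?_).1 Y hY
    · rw [hQ]
      ext i
      fin_cases i <;> simp [Matrix.mulVec, dotProduct, Fin.sum_univ_two]
      · linear_combination (√(n : ℝ))⁻¹ * h10'
      · linear_combination (√(n : ℝ))⁻¹ * h11'
    · rw [hQ]
      ext i
      fin_cases i <;> simp [Matrix.mulVec, dotProduct, Fin.sum_univ_two]
      · linear_combination (√(n : ℝ))⁻¹ * h20'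
      · linear_combination (√(n : ℝ))⁻¹ * h21'
  rcases hM with h | h
  · exact hmain _ h
  · have := hmain _ h
    simpa only [neg_smul_eq] using this

/-! ### The sum over the conjugacy classes -/

/-- `P` is conjugate to the representative with the parameters `i = (w, (a, d), x)`. -/
def IsRepresentedBy (N n : ℕ) (i : (_ : ℕ) × (_ : ℕ × ℕ) × ℤ) (P : SL(2, ℝ)) : Prop :=
  ∃ P' : SL(2, ℝ), IsScaled n (repMat i.1 i.2.1.1 i.2.1.2 i.2.2) P' ∧ Conj N P P'

/-- The set of all parameters `(w, (a, d), x)`. -/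
def indexSet (N n : ℕ) : Finset ((_ : ℕ) × (_ : ℕ × ℕ) × ℤ) :=
  N.divisors.sigma fun w => (pairs n).sigma fun p => entrySet N w p.1 p.2

theorem mem_pairs {n : ℕ} (hn : 0 < n) {p : ℕ × ℕ} :
    p ∈ pairs n ↔ 0 < p.1 ∧ 0 < p.2 ∧ p.1 ≠ p.2 ∧ p.1 * p.2 = n := by
  rw [pairs, Finset.mem_filter, Nat.mem_divisorsAntidiagonal]
  constructor
  · rintro ⟨⟨h, -⟩, hne⟩
    have h0 : 0 < p.1 * p.2 := h ▸ hn
    exact ⟨Nat.pos_of_mul_pos_right h0, Nat.pos_of_mul_pos_left h0, hne, h⟩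
  · rintro ⟨-, -, hne, h⟩
    exact ⟨⟨h, hn.ne'⟩, hne⟩

/-- Each class has a representative for either order of the eigenvalues. -/
theorem exists_isRepresentedBy {N n : ℕ} (hN : Squarefree N) (hn : 0 < n)
    (hnN : Nat.Coprime n N) {R : ℕ → ℕ → Prop} (htotal : ∀ a d, a ≠ d → R a d ∨ R d a)
    (P : HypTriv N n) :
    ∃ i ∈ indexSet N n, R i.2.1.1 i.2.1.2 ∧ IsRepresentedBy N n i P.1 := by
  obtain ⟨M, a, d, ha, hd, hne, had, hNM, hdet, htr, hM⟩ := exists_eigenvalues hn hnN P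
  obtain ⟨a, d, hR, ha, hd, hne, had, hdet, htr⟩ : ∃ a d : ℕ, R a d ∧ 0 < a ∧ 0 < d ∧ a ≠ d ∧
      a * d = n ∧ M.det = (a : ℤ) * d ∧ M.trace = (a : ℤ) + d := by
    rcases htotal a d hne with h | h
    · exact ⟨a, d, h, ha, hd, hne, had, hdet, htr⟩
    · exact ⟨d, a, h, hd, ha, hne.symm, (mul_comm _ _).trans had, hdet.trans (mul_comm _ _),
        htr.trans (add_comm _ _)⟩
  obtain ⟨w, hw, x, hx, g, hg, hgM⟩ := exists_conj_repMat hN hne hNM hdet htr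
  obtain ⟨P', hP'⟩ := exists_isScaled hn (M := repMat w a d x)
    (by rw [det_repMat, ← had]; push_cast; rfl)
  refine ⟨⟨w, (a, d), x⟩, ?_, hR, P', hP', ?_⟩
  · exact Finset.mem_sigma.mpr ⟨hw, Finset.mem_sigma.mpr
      ⟨(mem_pairs hn).mpr ⟨ha, hd, hne, had⟩, hx⟩⟩
  · have hneg : Conj N P.1 (-P.1) := ⟨1, one_mem _, Or.inr (by simp)⟩
    rcases hM with h | h
    · exact (conj_iff hn h hP').mpr ⟨g, hg, Or.inl hgM⟩
    · exact (Conj.equivalence N).trans hneg ((conj_iff hn h hP').mpr ⟨g, hg, Or.inl hgM⟩)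

/-- The conjugacy classes correspond to the parameters with one order of the eigenvalues. -/
theorem exists_equiv_indexSet {N n : ℕ} (hN : Squarefree N) (hn : 0 < n)
    (hnN : Nat.Coprime n N) {R : ℕ → ℕ → Prop} [DecidableRel R]
    (htotal : ∀ a d, a ≠ d → R a d ∨ R d a) (hasymm : ∀ a d, R a d → ¬ R d a) :
    ∃ e : HypClass N n ≃ {i // i ∈ (indexSet N n).filter fun i => R i.2.1.1 i.2.1.2},
      ∀ c, IsRepresentedBy N n (e c) (Quotient.out c).1 := by
  have hex := fun c : HypClass N n => exists_isRepresentedBy hN hn hnN htotal (Quotient.out c)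
  choose φ hφ hR hrep using hex
  have hinj : Function.Injective φ := by
    intro c c' h
    obtain ⟨P, hP, hc⟩ := hrep c
    obtain ⟨P', hP', hc'⟩ := hrep c'
    rw [← h] at hP'
    have : P = P' := Subtype.ext (hP.trans hP'.symm)
    subst this
    rw [← Quotient.out_eq c, ← Quotient.out_eq c']
    exact Quotient.sound ((Conj.equivalence N).trans hc ((Conj.equivalence N).symm hc'))
  have hsurj : ∀ i ∈ indexSet N n, R i.2.1.1 i.2.1.2 → ∃ c, φ c = i := by
    rintro ⟨w, ⟨a, d⟩, x⟩ hi hRi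
    obtain ⟨hw, hi'⟩ := Finset.mem_sigma.mp hi
    obtain ⟨hp, hx⟩ := Finset.mem_sigma.mp hi'
    obtain ⟨ha, hd, hne, had⟩ := (mem_pairs hn).mp hp
    obtain ⟨P, hP⟩ := exists_isScaled hn (M := repMat w a d x)
      (by rw [det_repMat, ← had]; push_cast; rfl)
    have hPt := hypTriv_of_repMat hn hnN ha hd hne had (mem_entrySet.mp hx).2.2 hP
    refine ⟨Quotient.mk _ ⟨P, hPt⟩, ?_⟩
    set c : HypClass N n := Quotient.mk _ ⟨P, hPt⟩ with hc
    have hout : Conj N (Quotient.out c).1 P := Quotient.exact (Quotient.out_eq c)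
    obtain ⟨P', hP', hc'⟩ := hrep c
    have hm := hφ c
    have hRc := hR c
    generalize φ c = j at hm hRc hP'
    obtain ⟨w', ⟨a', d'⟩, x'⟩ := j
    obtain ⟨hw', hj'⟩ := Finset.mem_sigma.mp hm
    obtain ⟨hp', hx'⟩ := Finset.mem_sigma.mp hj'
    obtain ⟨ha', hd', hne', had'⟩ := (mem_pairs hn).mp hp'
    have hPP' : Conj N P P' := (Conj.equivalence N).trans ((Conj.equivalence N).symm hout) hc'
    rcases eq_of_conj_repMat hN hn hw hw' ha ha' hne had had' hx hx' hP hP' hPP' with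
      ⟨rfl, rfl, rfl, rfl⟩ | ⟨h1, h2⟩
    · rfl
    · simp only at hRi hRc h1 h2
      rw [h1, h2] at hRi
      exact absurd hRi (hasymm _ _ hRc)
  refine ⟨Equiv.ofBijective (fun c => ⟨φ c, Finset.mem_filter.mpr ⟨hφ c, hR c⟩⟩) ⟨?_, ?_⟩, hrep⟩
  · intro c c' h
    exact hinj (congrArg Subtype.val h)
  · rintro ⟨i, hi⟩
    obtain ⟨hi1, hi2⟩ := Finset.mem_filter.mp hi
    obtain ⟨c, hc⟩ := hsurj i hi1 hi2
    exact ⟨c, Subtype.ext hc⟩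

/-- The main term of the truncated integral for the parameters `(w, (a, d), x)`. -/
def mainTerm (s : ℂ) (N n w a d : ℕ) (x : ℤ) (Y : ℝ) : ℂ :=
  ((2 * Real.log Y + |(a : ℝ) - d| * logTerm N w a d ((x : ℚ) / ((N / w : ℕ) : ℚ)) : ℝ) : ℂ) *
    (((√(n : ℝ) : ℝ) : ℂ) * gfun s (Real.log ((a : ℝ) / d)) / ((|(a : ℝ) - d| : ℝ) : ℂ)) +
    ∫ t in Set.Ioi (1 : ℝ), tailIntegrand s n a d t

/-- The sum of the main terms over all parameters is twice the explicit side of the formula. -/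
theorem sum_mainTerm (s : ℂ) {N n : ℕ} (hN : Squarefree N) (hn : 0 < n) (Y : ℝ) :
    ∑ i ∈ indexSet N n, mainTerm s N n i.1 i.2.1.1 i.2.1.2 i.2.2 Y =
    2 * ((nu N : ℂ) * ((√(n : ℝ) : ℝ) : ℂ) *
            (∑ p ∈ pairs n, gfun s (Real.log ((p.1 : ℝ) / p.2))) *
            ((Real.log Y : ℝ) : ℂ)
          + ((√(n : ℝ) : ℝ) : ℂ) / 2 *
            (∑ w ∈ N.divisors, ∑ p ∈ pairs n,
              ∑ᶠ b ∈ bSet N w p.1 p.2,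
                ((logTerm N w p.1 p.2 b : ℝ) : ℂ) * gfun s (Real.log ((p.1 : ℝ) / p.2)))
          + ∑ p ∈ pairs n,
              1 / 2 * (nu N : ℂ) * ((|(p.1 : ℝ) - p.2| : ℝ) : ℂ) *
                ∫ t in Set.Ioi (1 : ℝ), tailIntegrand s n p.1 p.2 t) := by
  have hinner : ∀ w ∈ N.divisors, ∀ p ∈ pairs n,
      ∑ x ∈ entrySet N w p.1 p.2, mainTerm s N n w p.1 p.2 x Y =
        2 * ((√(n : ℝ) : ℝ) : ℂ) * gfun s (Real.log ((p.1 : ℝ) / p.2)) * ((Real.log Y : ℝ) : ℂ) +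
        ((√(n : ℝ) : ℝ) : ℂ) * (∑ᶠ b ∈ bSet N w p.1 p.2,
          ((logTerm N w p.1 p.2 b : ℝ) : ℂ) * gfun s (Real.log ((p.1 : ℝ) / p.2))) +
        ((|(p.1 : ℝ) - p.2| : ℝ) : ℂ) * ∫ t in Set.Ioi (1 : ℝ), tailIntegrand s n p.1 p.2 t := by
    intro w hw p hp
    obtain ⟨-, hh0, -, -⟩ := exists_mul_eq_isCoprime hN hw
    obtain ⟨-, -, hne, -⟩ := (mem_pairs hn).mp hp
    have habs : ((|(p.1 : ℝ) - p.2| : ℝ) : ℂ) ≠ 0 := by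
      have : (p.1 : ℝ) - p.2 ≠ 0 := sub_ne_zero.mpr (by exact_mod_cast hne)
      exact_mod_cast abs_ne_zero.mpr this
    have hcard : ((entrySet N w p.1 p.2).card : ℂ) = ((|(p.1 : ℝ) - p.2| : ℝ) : ℂ) := by
      have h := card_entrySet hN hw p.1 p.2
      have h' : ((entrySet N w p.1 p.2).card : ℝ) = |(p.1 : ℝ) - p.2| := by
        exact_mod_cast congrArg (Int.cast : ℤ → ℝ) h
      rw [← h']
      norm_cast
    rw [bSet_eq_image hN hw, finsum_mem_image ((injective_div_width hh0).injOn),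
      finsum_mem_coe_finset, ← hcard]
    rw [← hcard] at habs
    simp only [mainTerm]
    have hterm : ∀ x : ℤ, ((2 * Real.log Y + |(p.1 : ℝ) - p.2| *
        logTerm N w p.1 p.2 ((x : ℚ) / ((N / w : ℕ) : ℚ)) : ℝ) : ℂ) *
        (((√(n : ℝ) : ℝ) : ℂ) * gfun s (Real.log ((p.1 : ℝ) / p.2)) /
          ((|(p.1 : ℝ) - p.2| : ℝ) : ℂ)) +
        ∫ t in Set.Ioi (1 : ℝ), tailIntegrand s n p.1 p.2 t =
        (2 * ((√(n : ℝ) : ℝ) : ℂ) * gfun s (Real.log ((p.1 : ℝ) / p.2)) *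
          ((Real.log Y : ℝ) : ℂ) / ((entrySet N w p.1 p.2).card : ℂ) +
          ∫ t in Set.Ioi (1 : ℝ), tailIntegrand s n p.1 p.2 t) +
        ((√(n : ℝ) : ℝ) : ℂ) * (((logTerm N w p.1 p.2 ((x : ℚ) / ((N / w : ℕ) : ℚ)) : ℝ) : ℂ) *
          gfun s (Real.log ((p.1 : ℝ) / p.2))) := by
      intro x
      rw [Complex.ofReal_add, Complex.ofReal_mul, Complex.ofReal_mul |(p.1 : ℝ) - p.2|, ← hcard]
      push_cast
      field_simp
      ring
    simp only [hterm]
    rw [Finset.sum_add_distrib, Finset.sum_const, nsmul_eq_mul, ← Finset.mul_sum]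
    field_simp
    ring
  rw [indexSet, Finset.sum_sigma]
  simp only [Finset.sum_sigma]
  rw [Finset.sum_congr rfl fun w hw => Finset.sum_congr rfl fun p hp => hinner w hw p hp]
  simp only [Finset.sum_add_distrib, Finset.sum_const, nsmul_eq_mul, ← Finset.mul_sum,
    ← Finset.sum_mul]
  rw [nu_eq_card hN]
  have h3 : ∑ p ∈ pairs n, 1 / 2 * (N.divisors.card : ℂ) * ((|(p.1 : ℝ) - p.2| : ℝ) : ℂ) *
      ∫ t in Set.Ioi (1 : ℝ), tailIntegrand s n p.1 p.2 t =
      1 / 2 * (N.divisors.card : ℂ) * ∑ p ∈ pairs n, ((|(p.1 : ℝ) - p.2| : ℝ) : ℂ) *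
        ∫ t in Set.Ioi (1 : ℝ), tailIntegrand s n p.1 p.2 t := by
    rw [Finset.mul_sum]
    exact Finset.sum_congr rfl fun p _ => by ring
  rw [h3]
  ring

/-- The asymptotics of `c(P)_Y` for a single conjugacy class. -/
theorem tendsto_cClass {ι : Type*} {s : ℂ} (hs : 1 < s.re) {N n : ℕ} (hN : Squarefree N)
    (hn : 0 < n) {σ : ι → SL(2, ℝ)} (hσ : IsCuspSystem N σ) {D : Set ℍ}
    (hD : IsFundamentalDomainAt N σ D) {c : HypClass N n} {i : (_ : ℕ) × (_ : ℕ × ℕ) × ℤ}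
    (hi : i ∈ indexSet N n) (hc : IsRepresentedBy N n i (Quotient.out c).1) :
    Filter.Tendsto (fun Y : ℝ => cClass s N n σ D Y c -
      mainTerm s N n i.1 i.2.1.1 i.2.1.2 i.2.2 Y) Filter.atTop (nhds 0) := by
  obtain ⟨w, ⟨a, d⟩, x⟩ := i
  obtain ⟨hw, hi'⟩ := Finset.mem_sigma.mp hi
  obtain ⟨hp, -⟩ := Finset.mem_sigma.mp hi'
  obtain ⟨ha, hd, hne, had⟩ := (mem_pairs hn).mp hp
  obtain ⟨P', hP', hconj⟩ := hc
  obtain ⟨Y₀, hY₀⟩ := truncPlane_ae_eq_thickPart hN.ne_zero hσ hD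
  refine (tendsto_integral_repMat hs hN hw ha hd hne had x hP').congr' ?_
  filter_upwards [Filter.eventually_gt_atTop Y₀] with Y hY
  have h1 : cClass s N n σ D Y c = cTrunc s N σ D Y (Quotient.out c).1 := by
    conv_lhs => rw [← Quotient.out_eq c]
    rfl
  rw [h1, cTrunc_conj s N σ D Y hconj, cTrunc, setIntegral_congr_set (hY₀ Y hY)]
  rfl

/-- The two enumerations of the classes, one for either order of the eigenvalues, exhaust the
parameters. -/
theorem sum_add_sum_eq_sum_indexSet {N n : ℕ} (hn : 0 < n) [Fintype (HypClass N n)]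
    (e₁ : HypClass N n ≃ {i // i ∈ (indexSet N n).filter fun i => i.2.1.2 < i.2.1.1})
    (e₂ : HypClass N n ≃ {i // i ∈ (indexSet N n).filter fun i => i.2.1.1 < i.2.1.2})
    (F : (_ : ℕ) × (_ : ℕ × ℕ) × ℤ → ℂ) :
    ∑ c, F (e₁ c).1 + ∑ c, F (e₂ c).1 = ∑ i ∈ indexSet N n, F i := by
  have h₁ := e₁.sum_comp fun i => F i.1
  have h₂ := e₂.sum_comp fun i => F i.1
  rw [h₁, h₂, Finset.sum_coe_sort _ F, Finset.sum_coe_sort _ F,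
    ← Finset.sum_filter_add_sum_filter_not (indexSet N n) fun i => i.2.1.2 < i.2.1.1]
  congr 2
  refine Finset.filter_congr fun i hi => ?_
  have hp := (Finset.mem_sigma.mp (Finset.mem_sigma.mp hi).2).1
  have := ((mem_pairs hn).mp hp).2.2.1
  omega

end

end HeckeTrace

theorem theorem3p9 {ι : Type*} (N n : ℕ) (hN : Squarefree N) (hn : 0 < n)
    (hnN : Nat.Coprime n N) (s : ℂ) (hs : 1 < s.re)
    (σ : ι → SL(2, ℝ)) (hσ : HeckeTrace.IsCuspSystem N σ)
    (D : Set ℍ) (hD : HeckeTrace.IsFundamentalDomainAt N σ D) :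
    -- the sums are finite and the integrals converge absolutely
    Finite (HeckeTrace.HypClass N n) ∧
    (∀ᶠ Y : ℝ in Filter.atTop, ∀ P : HeckeTrace.HypTriv N n,
      IntegrableOn (fun z : ℍ => HeckeTrace.kernel s z (P.1 • z))
        (HeckeTrace.truncPlane N σ D Y) volume) ∧
    (∀ p ∈ HeckeTrace.pairs n,
      IntegrableOn (HeckeTrace.tailIntegrand s n p.1 p.2) (Set.Ioi 1) volume) ∧
    -- the sum over `b` has `|a - d|` terms
    (∀ w ∈ N.divisors, ∀ p ∈ HeckeTrace.pairs n,
      ((HeckeTrace.bSet N w p.1 p.2).ncard : ℤ) = |(p.1 : ℤ) - p.2|) ∧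
    -- the asymptotic formula
    Filter.Tendsto
      (fun Y : ℝ =>
        (∑ᶠ c : HeckeTrace.HypClass N n, HeckeTrace.cClass s N n σ D Y c) -
        ((HeckeTrace.nu N : ℂ) * ((√(n : ℝ) : ℝ) : ℂ) *
            (∑ p ∈ HeckeTrace.pairs n, HeckeTrace.gfun s (Real.log ((p.1 : ℝ) / p.2))) *
            ((Real.log Y : ℝ) : ℂ)
          + ((√(n : ℝ) : ℝ) : ℂ) / 2 *
            (∑ w ∈ N.divisors, ∑ p ∈ HeckeTrace.pairs n,
              ∑ᶠ b ∈ HeckeTrace.bSet N w p.1 p.2,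
                ((HeckeTrace.logTerm N w p.1 p.2 b : ℝ) : ℂ) *
                  HeckeTrace.gfun s (Real.log ((p.1 : ℝ) / p.2)))
          + ∑ p ∈ HeckeTrace.pairs n,
              1 / 2 * (HeckeTrace.nu N : ℂ) * ((|(p.1 : ℝ) - p.2| : ℝ) : ℂ) *
                ∫ t in Set.Ioi (1 : ℝ), HeckeTrace.tailIntegrand s n p.1 p.2 t))
      Filter.atTop (nhds 0) := by
  have hn0 : N ≠ 0 := hN.ne_zero
  obtain ⟨e₁, he₁⟩ := HeckeTrace.exists_equiv_indexSet hN hn hnN (R := fun a d => d < a)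
    (fun a d h => h.lt_or_gt.symm) (fun a d h => h.asymm)
  obtain ⟨e₂, he₂⟩ := HeckeTrace.exists_equiv_indexSet hN hn hnN (R := fun a d => a < d)
    (fun a d h => h.lt_or_gt) (fun a d h => h.asymm)
  have hfin : Finite (HeckeTrace.HypClass N n) := Finite.of_equiv _ e₁.symm
  refine ⟨hfin, ?_, ?_, ?_, ?_⟩
  · obtain ⟨Y₀, hY₀⟩ := HeckeTrace.truncPlane_ae_eq_thickPart hn0 hσ hD
    filter_upwards [Filter.eventually_gt_atTop Y₀, Filter.eventually_gt_atTop 0] with Y hY hY' P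
    exact (HeckeTrace.integrableOn_kernel_thickPart hs hn0 hn hnN P hY').congr_set_ae (hY₀ Y hY)
  · intro p hp
    exact (HeckeTrace.integral_log_profile hs hn ((HeckeTrace.mem_pairs hn).mp hp).2.2.1).1
  · intro w hw p _
    exact HeckeTrace.ncard_bSet hN hw p.1 p.2
  · have : Fintype (HeckeTrace.HypClass N n) := Fintype.ofFinite _
    have hlim := tendsto_finsetSum (Finset.univ : Finset (HeckeTrace.HypClass N n)) fun c _ =>
      ((HeckeTrace.tendsto_cClass hs hN hn hσ hD (Finset.mem_filter.mp (e₁ c).2).1 (he₁ c)).add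
        (HeckeTrace.tendsto_cClass hs hN hn hσ hD (Finset.mem_filter.mp (e₂ c).2).1 (he₂ c))).const_mul
          (1 / 2 : ℂ)
    simp only [add_zero, mul_zero, Finset.sum_const_zero] at hlim
    refine hlim.congr fun Y => ?_
    -- each class is counted twice, once for either order of the two eigenvalues
    have hsplit := HeckeTrace.sum_add_sum_eq_sum_indexSet hn e₁ e₂ fun i =>
      HeckeTrace.mainTerm s N n i.1 i.2.1.1 i.2.1.2 i.2.2 Y
    rw [HeckeTrace.sum_mainTerm s hN hn Y] at hsplit
    rw [finsum_eq_sum_of_fintype, ← Finset.mul_sum, Finset.sum_add_distrib,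
      Finset.sum_sub_distrib, Finset.sum_sub_distrib]
    linear_combination (-1 / 2 : ℂ) * hsplit
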